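/- Let $T=[0,1]^2$. Let $r_0:\mathbb R\to\{-1,1\}$ have period $1$, with $r_0=1$ on $[0,\frac12)$ and $r_0=-1$ on $[\frac12,1)$; put $r_k(x)=r_0(2^kx)$, and let $W_n=\prod_{s=1}^{j} r_{m_s}$ for $n=\sum_{s=1}^{j}2^{m_s}$ with $m_1>\dots>m_j\ge 0$ be the Walsh functions in Paley order. For a measurable weight $\mu$ on $T$ with $0<\mu\le 1$, let $L^1_\mu(T)$ be the space of real measurable functions $f$ on $T$ with $\iint_T|f|\,\mu\,dx\,dy<\infty$. There exists a double Walsh series $$\sum_{n,k=1}^\infty c_{n,k}W_n(x)W_k(y),\qquad c_{n,k}\in\mathbb R,\qquad \sum_{n,k=1}^\infty|c_{n,k}|^q<\infty\ \text{ for all } q>2,$$ with the following property. For every $\varepsilon>0$ there is a measurable function $\mu$ on $T$ with $0<\mu\le 1$ and $|\{(x,y)\in T:\mu(x,y)\ne1\}|<\varepsilon$ such that the series is universal in $L^1_\mu(T)$ concerning rearrangements, with respect to both rectangular and spherical convergence. That is, writing $u_{n,k}(x,y)=c_{n,k}W_n(x)W_k(y)$, for every $f\in L^1_\mu(T)$ there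 is a bijection $\sigma$ of $\{1,2,\dots\}^2$ onto itself such that $$\lim_{n,m\to\infty}\iint_T\Bigl|\sum_{i=1}^{n}\sum_{j=1}^{m}u_{\sigma(i,j)}-f\Bigr|\,\mu\,dx\,dy=0 \quad\text{and}\quad \lim_{R\to\infty}\iint_T\Bigl|\sum_{i,j\ge1,\ i^2+j^2\le R^2}u_{\sigma(i,j)}-f\Bigr|\,\mu\,dx\,dy=0,$$ where in the first limit $n$ and $m$ tend to infinity independently of each other. -/

import Mathlib

open MeasureTheory Filter Topology

noncomputable section

/-- The Rademacher function `r_k(x) = r_0(2^k x)`, where `r_0` has period one, equals `1` on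
`[0, 1/2)` and `-1` on `[1/2, 1)`. -/
def rademacher (k : ℕ) (x : ℝ) : ℝ :=
  if Int.fract (2 ^ k * x) < 1 / 2 then 1 else -1

/-- The Walsh function `W_n` in the Paley ordering: the product of the `r_m` over the exponents `m`
in the binary expansion of `n`; in particular `W_0 = 1`. -/
def walsh (n : ℕ) (x : ℝ) : ℝ :=
  (n.bitIndices.map fun m => rademacher m x).prod

/-- The unit square `T = [0,1]²`. -/
def unitSquare : Set (ℝ × ℝ) := Set.Icc 0 1 ×ˢ Set.Icc 0 1

/-- `f` belongs to the weighted space `L¹_μ(T)`. -/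
def MemWeightedL1 (μ f : ℝ × ℝ → ℝ) : Prop :=
  AEMeasurable f (volume.restrict unitSquare) ∧
    IntegrableOn (fun p => |f p| * μ p) unitSquare

/-- The distance of `f` and `g` in the metric of `L¹_μ(T)`. -/
def weightedDist (μ f g : ℝ × ℝ → ℝ) : ℝ :=
  ∫ p in unitSquare, |f p - g p| * μ p

/-- The index set `1 ≤ k ≤ n`, `1 ≤ ν ≤ m` of a rectangular partial sum. -/
def rectIndices (N : ℕ+ × ℕ+) : Finset (ℕ+ × ℕ+) :=
  Finset.Icc 1 N.1 ×ˢ Finset.Icc 1 N.2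

/-- The index set `k² + ν² ≤ R²`, `k, ν ≥ 1`, of a spherical partial sum; the membership lemma
below shows that the bounding box used here loses nothing. -/
def spherIndices (R : ℝ) : Finset (ℕ+ × ℕ+) :=
  (rectIndices (⌊|R|⌋₊.succPNat, ⌊|R|⌋₊.succPNat)).filter
    fun i => ((i.1 : ℕ) : ℝ) ^ 2 + ((i.2 : ℕ) : ℝ) ^ 2 ≤ R ^ 2

theorem mem_spherIndices (R : ℝ) (i : ℕ+ × ℕ+) :
    i ∈ spherIndices R ↔ ((i.1 : ℕ) : ℝ) ^ 2 + ((i.2 : ℕ) : ℝ) ^ 2 ≤ R ^ 2 := by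
  have key : ∀ k : ℕ+, ((k : ℕ) : ℝ) ^ 2 ≤ R ^ 2 → k ≤ ⌊|R|⌋₊.succPNat := by
    intro k hk
    have h1 : ((k : ℕ) : ℝ) ≤ |R| := by
      have := sq_le_sq.mp hk
      simpa using this
    have h2 : (k : ℕ) ≤ ⌊|R|⌋₊ := Nat.le_floor h1
    rw [← PNat.coe_le_coe, Nat.succPNat_coe]
    omega
  simp only [spherIndices, rectIndices, Finset.mem_filter, Finset.mem_product, Finset.mem_Icc,
    one_le, true_and, and_iff_right_iff_imp]
  intro h
  exact ⟨key _ (by nlinarith [sq_nonneg ((i.2 : ℕ) : ℝ)]),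
    key _ (by nlinarith [sq_nonneg ((i.1 : ℕ) : ℝ)])⟩

/-- The double functional series with terms `u (n, k)`, `n, k ≥ 1`, converges to `f` in `L¹_μ(T)` in
the sense of rectangular partial sums (both sides of the rectangle tend to infinity
independently). -/
def RectConverges (μ : ℝ × ℝ → ℝ) (u : ℕ+ × ℕ+ → ℝ × ℝ → ℝ) (f : ℝ × ℝ → ℝ) : Prop :=
  Tendsto (fun N : ℕ+ × ℕ+ => weightedDist μ (fun p => ∑ i ∈ rectIndices N, u i p) f)
    atTop (𝓝 0)

/-- The same in the sense of spherical partial sums. -/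
def SpherConverges (μ : ℝ × ℝ → ℝ) (u : ℕ+ × ℕ+ → ℝ × ℝ → ℝ) (f : ℝ × ℝ → ℝ) : Prop :=
  Tendsto (fun R : ℝ => weightedDist μ (fun p => ∑ i ∈ spherIndices R, u i p) f)
    atTop (𝓝 0)

/-- A double functional series with terms in `L¹_μ(T)` is universal in `L¹_μ(T)` concerning
rearrangements, with respect to both rectangular and spherical convergence: for each `f` in
`L¹_μ(T)` the terms can be rearranged into a double series that converges to `f` in both senses. -/
def IsUniversalRearrangements (μ : ℝ × ℝ → ℝ) (u : ℕ+ × ℕ+ → ℝ × ℝ → ℝ) : Prop :=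
  (∀ i, MemWeightedL1 μ (u i)) ∧
    ∀ f : ℝ × ℝ → ℝ, MemWeightedL1 μ f →
      ∃ σ : Equiv.Perm (ℕ+ × ℕ+),
        RectConverges μ (fun i => u (σ i)) f ∧ SpherConverges μ (fun i => u (σ i)) f

/-- The term `c_{n,k} W_n(x) W_k(y)` of a double Walsh series. -/
def walshTerm (c : ℕ+ × ℕ+ → ℝ) (i : ℕ+ × ℕ+) (p : ℝ × ℝ) : ℝ :=
  c i * walsh i.1 p.1 * walsh i.2 p.2

end

/-!
The universal series is a concatenation of blocks, one for each member of a sequence in which every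
dyadic step function with rational values recurs infinitely often.

The block of a step function `g` comes from the function
`1_I - 2^a 1_{I'}`, where `I` is a dyadic cylinder and `I' ⊆ I` is the part on which `a` further
Rademacher functions `r_s`, `s ∈ U`, equal one. Expanding both indicators as products
`∏ (1 ± r_s) / 2` shows that all Walsh coefficients of this function without a frequency in `U`
cancel and that the remaining ones are `±|I|` (`modifiedIndicator_eq_sum`). A tensor product of two
such functions times the value of `g` on a cell is therefore a double Walsh polynomial that has
frequencies as high as desired and agrees with `g 1_cell` off a small part of the cell
(`exists_walshPoly_cell`). When `g` is regarded as a step function on a grid of mesh `2^(-P)` and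
the cells use disjoint frequencies, the sum over all cells of the squares of the coefficients is
bounded uniformly in `P`, while each coefficient is `O(4^(-P))` and the `L²` norm attached to a
single cell is `O(2^(-P))`. Hence, for large `P`, the coefficients are small in `ℓ^(2+δ)`, and a
partial sum of the block, being a sum over complete cells plus part of one cell, is dominated by
`|g|` up to a small error off the exceptional set (`exists_isWalshBlock`).

The exceptional sets `B s` of the blocks have summable measures. By the Borel–Cantelli lemma almost
every point lies in finitely many of them, so a positive weight that is one off `⋃_{s ≥ s₀} B s` can
be chosen so small on each `B s` that the block there is negligible (`exists_weight`). In the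
weighted `L¹` space every element is then approximated by blocks with arbitrarily high frequencies
whose partial sums are under control, and the terms of the series tend to zero. This is enough to
rearrange the terms into a simple series with any prescribed sum (`exists_rearrangement_tendsto`).

Finally, no frequency `(1, k)` is used, so infinitely many coefficients vanish. These fill the
positions off the diagonal, and the other terms follow the simple series along the diagonal. The
rectangular and the spherical partial sums are then partial sums of that simple series
(`rectConverges_and_spherConverges_of_diagonal`).
-/

/-! ### Rademacher and Walsh functions on the line -/

theorem rademacher_eq_or (k : ℕ) (x : ℝ) : rademacher k x = 1 ∨ rademacher k x = -1 := by
  unfold rademacher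
  split_ifs <;> simp

theorem rademacher_mul_self (k : ℕ) (x : ℝ) : rademacher k x * rademacher k x = 1 := by
  rcases rademacher_eq_or k x with h | h <;> simp [h]

theorem abs_rademacher (k : ℕ) (x : ℝ) : |rademacher k x| = 1 := by
  rcases rademacher_eq_or k x with h | h <;> simp [h]

theorem measurable_rademacher (k : ℕ) : Measurable (rademacher k) := by
  refine Measurable.ite ?_ measurable_const measurable_const
  exact measurableSet_lt (measurable_fract.comp (measurable_const.mul measurable_id))
    measurable_const

theorem rademacher_add_nat_mul (k m : ℕ) (x t : ℝ) (h : 2 ^ k * t = m) :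
    rademacher k (x + t) = rademacher k x := by
  unfold rademacher
  rw [mul_add, h, Int.fract_add_natCast]

theorem rademacher_add_half (k : ℕ) (x : ℝ) :
    rademacher k (x + (2 ^ (k + 1))⁻¹) = -rademacher k x := by
  have h : (2 : ℝ) ^ k * (x + (2 ^ (k + 1))⁻¹) = 2 ^ k * x + 1 / 2 := by
    rw [pow_succ]; field_simp
  unfold rademacher
  rw [h]
  set y := (2 : ℝ) ^ k * x
  have h0 := Int.fract_nonneg y
  have h1 := Int.fract_lt_one y
  have e : y + 1 / 2 = (Int.fract y + 1 / 2) + (⌊y⌋ : ℤ) := by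
    have := Int.fract_add_floor y
    linarith
  rw [e, Int.fract_add_intCast]
  by_cases hy : Int.fract y < 1 / 2
  · rw [Int.fract_eq_self.2 ⟨by linarith, by linarith⟩, if_neg (by linarith), if_pos hy]
  · have : Int.fract (Int.fract y + 1 / 2) = Int.fract y - 1 / 2 := by
      rw [show Int.fract y + 1 / 2 = (Int.fract y - 1 / 2) + (1 : ℤ) by push_cast; ring,
        Int.fract_add_intCast]
      exact Int.fract_eq_self.2 ⟨by linarith, by linarith⟩
    rw [this, if_pos (by linarith), if_neg hy]
    norm_num

/-- The product of the Rademacher functions `r_s`, `s ∈ S`. -/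
noncomputable def rademacherProd (S : Finset ℕ) (x : ℝ) : ℝ := ∏ s ∈ S, rademacher s x

theorem abs_rademacherProd (S : Finset ℕ) (x : ℝ) : |rademacherProd S x| = 1 := by
  simp [rademacherProd, Finset.abs_prod, abs_rademacher]

theorem measurable_rademacherProd (S : Finset ℕ) : Measurable (rademacherProd S) :=
  Finset.measurable_prod S fun s _ => measurable_rademacher s

theorem rademacherProd_mul (S U : Finset ℕ) (x : ℝ) :
    rademacherProd S x * rademacherProd U x = rademacherProd (symmDiff S U) x := by
  have key : ∀ A B : Finset ℕ, rademacherProd A x =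
      rademacherProd (A \ B) x * rademacherProd (A ∩ B) x := by
    intro A B
    unfold rademacherProd
    rw [mul_comm, Finset.prod_inter_mul_prod_sdiff]
  have hsq : rademacherProd (S ∩ U) x * rademacherProd (S ∩ U) x = 1 := by
    unfold rademacherProd
    rw [← Finset.prod_mul_distrib]
    exact Finset.prod_eq_one fun s _ => rademacher_mul_self s x
  have hd : rademacherProd (symmDiff S U) x =
      rademacherProd (S \ U) x * rademacherProd (U \ S) x := by
    rw [symmDiff_def, Finset.sup_eq_union]
    exact Finset.prod_union (disjoint_sdiff_sdiff)
  rw [key S U, key U S, hd, Finset.inter_comm U S]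
  linear_combination rademacherProd (S \ U) x * rademacherProd (U \ S) x * hsq

/-- Translation by half a period of the slowest factor changes the sign of the product and keeps
the integral over a period. -/
theorem integral_rademacherProd_eq_zero {S : Finset ℕ} (hS : S.Nonempty) :
    ∫ x in Set.Icc (0 : ℝ) 1, rademacherProd S x = 0 := by
  rw [integral_Icc_eq_integral_Ioc, ← intervalIntegral.integral_of_le zero_le_one]
  set k := S.min' hS
  set t : ℝ := (2 ^ (k + 1))⁻¹
  have hanti : ∀ x, rademacherProd S (x + t) = -rademacherProd S x := by
    intro x
    unfold rademacherProd
    have hk : k ∈ S := S.min'_mem hS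
    rw [← Finset.mul_prod_erase S _ hk, ← Finset.mul_prod_erase S (fun s => rademacher s x) hk,
      rademacher_add_half, neg_mul]
    congr 2
    refine Finset.prod_congr rfl fun j hj => ?_
    have hlt : k < j := lt_of_le_of_ne (S.min'_le j (Finset.mem_of_mem_erase hj))
      (Finset.ne_of_mem_erase hj).symm
    obtain ⟨d, rfl⟩ := Nat.exists_eq_add_of_lt hlt
    refine rademacher_add_nat_mul _ (2 ^ d) _ _ ?_
    simp only [t]
    push_cast
    rw [show k + d + 1 = d + (k + 1) by ring, pow_add, mul_assoc,
      mul_inv_cancel₀ (by positivity), mul_one]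
  have hper : Function.Periodic (rademacherProd S) 1 := by
    intro x
    unfold rademacherProd
    exact Finset.prod_congr rfl fun j _ =>
      rademacher_add_nat_mul j (2 ^ j) x 1 (by push_cast; ring)
  have h1 : ∫ x in (0 : ℝ)..1, rademacherProd S (x + t) = ∫ x in (0 : ℝ)..1, rademacherProd S x := by
    rw [intervalIntegral.integral_comp_add_right, add_comm 1 t, zero_add,
      hper.intervalIntegral_add_eq t 0, zero_add]
  simp only [hanti, intervalIntegral.integral_neg] at h1
  linarith

theorem integral_rademacherProd_empty : ∫ x in Set.Icc (0 : ℝ) 1, rademacherProd ∅ x = 1 := by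
  simp [rademacherProd]

theorem walsh_eq_rademacherProd (n : ℕ) (x : ℝ) :
    walsh n x = rademacherProd n.bitIndices.toFinset x :=
  (List.prod_toFinset _ Nat.bitIndices_nodup).symm

theorem walsh_sum_two_pow (S : Finset ℕ) (x : ℝ) :
    walsh (∑ s ∈ S, 2 ^ s) x = rademacherProd S x := by
  rw [walsh_eq_rademacherProd, Finset.toFinset_bitIndices_sum_two_pow]

theorem sum_two_pow_injective : Function.Injective fun S : Finset ℕ => ∑ s ∈ S, 2 ^ s := by
  intro S U h
  have := congrArg (fun n : ℕ => n.bitIndices.toFinset) h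
  simpa using this

theorem measurable_walsh (n : ℕ) : Measurable (walsh n) := by
  have : walsh n = rademacherProd n.bitIndices.toFinset := funext (walsh_eq_rademacherProd n)
  rw [this]
  exact measurable_rademacherProd _

theorem abs_walsh (n : ℕ) (x : ℝ) : |walsh n x| = 1 := by
  rw [walsh_eq_rademacherProd, abs_rademacherProd]

theorem integral_walsh_mul {m n : ℕ} (h : m ≠ n) :
    ∫ x in Set.Icc (0 : ℝ) 1, walsh m x * walsh n x = 0 := by
  simp only [walsh_eq_rademacherProd, rademacherProd_mul]
  refine integral_rademacherProd_eq_zero ?_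
  rw [Finset.nonempty_iff_ne_empty, Ne, ← Finset.bot_eq_empty, symmDiff_eq_bot]
  intro h'
  apply h
  have := congrArg (fun S : Finset ℕ => ∑ s ∈ S, 2 ^ s) h'
  simpa using this

/-! ### Dyadic cylinders -/

/-- The sign pattern that is `-1` exactly on `A`. -/
def patternSign (A : Finset ℕ) (s : ℕ) : ℝ := if s ∈ A then -1 else 1

theorem patternSign_mul_self (A : Finset ℕ) (s : ℕ) : patternSign A s * patternSign A s = 1 := by
  unfold patternSign; split_ifs <;> norm_num

theorem abs_prod_patternSign (A S : Finset ℕ) : |∏ s ∈ S, patternSign A s| = 1 := by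
  rw [Finset.abs_prod]
  refine Finset.prod_eq_one fun s _ => ?_
  unfold patternSign; split_ifs <;> norm_num

/-- The set on which the Rademacher functions `r_s`, `s ∈ D`, take the values prescribed by the
sign pattern of `A`. -/
def cylinderSet (D A : Finset ℕ) : Set ℝ := {x | ∀ s ∈ D, rademacher s x = patternSign A s}

theorem cylinderSet_anti {D E : Finset ℕ} (h : D ⊆ E) (A : Finset ℕ) :
    cylinderSet E A ⊆ cylinderSet D A := fun _ hx s hs => hx s (h hs)

theorem measurableSet_cylinderSet (D A : Finset ℕ) : MeasurableSet (cylinderSet D A) := by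
  have : cylinderSet D A = ⋂ s ∈ D, {x | rademacher s x = patternSign A s} := by
    ext x; simp [cylinderSet]
  rw [this]
  exact Finset.measurableSet_biInter D fun s _ =>
    measurableSet_eq_fun (measurable_rademacher s) measurable_const

/-- The Walsh expansion of the indicator of a cylinder, from `∏ (1 ± r_s)`. -/
theorem sum_patternSign_mul_rademacherProd (D A : Finset ℕ) (x : ℝ) :
    ∑ S ∈ D.powerset, (∏ s ∈ S, patternSign A s) * rademacherProd S x =
      2 ^ D.card * (cylinderSet D A).indicator 1 x := by
  have h1 : ∑ S ∈ D.powerset, (∏ s ∈ S, patternSign A s) * rademacherProd S x =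
      ∏ s ∈ D, (1 + patternSign A s * rademacher s x) := by
    rw [Finset.prod_one_add]
    exact Finset.sum_congr rfl fun S _ => by rw [rademacherProd, Finset.prod_mul_distrib]
  rw [h1]
  by_cases hx : x ∈ cylinderSet D A
  · rw [Set.indicator_of_mem hx, Pi.one_apply, mul_one, ← Finset.prod_const]
    refine Finset.prod_congr rfl fun s hs => ?_
    rw [hx s hs, patternSign_mul_self]; norm_num
  · rw [Set.indicator_of_notMem hx, mul_zero]
    simp only [cylinderSet, Set.mem_ofPred_eq, not_forall] at hx
    obtain ⟨s, hs, hne⟩ := hx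
    refine Finset.prod_eq_zero hs ?_
    unfold patternSign at hne ⊢
    rcases rademacher_eq_or s x with h | h <;> rw [h] at hne ⊢ <;> split_ifs at hne ⊢ <;>
      simp_all

theorem integrable_rademacherProd (S : Finset ℕ) :
    Integrable (rademacherProd S) (volume.restrict (Set.Icc (0 : ℝ) 1)) :=
  Integrable.of_bound (measurable_rademacherProd S).aestronglyMeasurable 1
    (ae_of_all _ fun x => (abs_rademacherProd S x).le)

theorem measureReal_cylinderSet (D A : Finset ℕ) :
    (volume.restrict (Set.Icc (0 : ℝ) 1)).real (cylinderSet D A) = (2 ^ D.card)⁻¹ := by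
  have h : ∫ x in Set.Icc (0 : ℝ) 1, (2 : ℝ) ^ D.card * (cylinderSet D A).indicator 1 x = 1 := by
    simp only [← sum_patternSign_mul_rademacherProd]
    rw [integral_finsetSum _ fun S _ => (integrable_rademacherProd S).const_mul _]
    simp only [integral_const_mul]
    rw [Finset.sum_eq_single ∅]
    · simp [integral_rademacherProd_empty]
    · intro S _ hS
      rw [integral_rademacherProd_eq_zero (Finset.nonempty_iff_ne_empty.2 hS), mul_zero]
    · simp
  rw [integral_const_mul, integral_indicator_one (measurableSet_cylinderSet D A)] at h
  field_simp at h ⊢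
  linarith

theorem measure_cylinderSet (D A : Finset ℕ) :
    volume.restrict (Set.Icc (0 : ℝ) 1) (cylinderSet D A) = ENNReal.ofReal (2 ^ D.card)⁻¹ := by
  rw [← measureReal_cylinderSet D A, ofReal_measureReal]

/-! ### Double Walsh polynomials -/

theorem volume_restrict_unitSquare : volume.restrict unitSquare =
    (volume.restrict (Set.Icc (0 : ℝ) 1)).prod (volume.restrict (Set.Icc (0 : ℝ) 1)) := by
  rw [Measure.prod_restrict, unitSquare, Measure.volume_eq_prod]

instance isProbabilityMeasure_unitSquare :
    IsProbabilityMeasure ((volume : Measure (ℝ × ℝ)).restrict unitSquare) := by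
  constructor
  rw [volume_restrict_unitSquare, ← Set.univ_prod_univ, Measure.prod_prod]
  simp

/-- The product function `W_n(x) W_k(y)`. -/
noncomputable def walshPair (i : ℕ+ × ℕ+) (p : ℝ × ℝ) : ℝ := walsh i.1 p.1 * walsh i.2 p.2

theorem walshTerm_eq (c : ℕ+ × ℕ+ → ℝ) (i : ℕ+ × ℕ+) (p : ℝ × ℝ) :
    walshTerm c i p = c i * walshPair i p := mul_assoc _ _ _

theorem abs_walshPair (i : ℕ+ × ℕ+) (p : ℝ × ℝ) : |walshPair i p| = 1 := by
  rw [walshPair, abs_mul, abs_walsh, abs_walsh, one_mul]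

theorem walshPair_mul_self (i : ℕ+ × ℕ+) (p : ℝ × ℝ) : walshPair i p * walshPair i p = 1 := by
  rw [← abs_mul_abs_self, abs_walshPair, one_mul]

theorem measurable_walshPair (i : ℕ+ × ℕ+) : Measurable (walshPair i) :=
  ((measurable_walsh _).comp measurable_fst).mul ((measurable_walsh _).comp measurable_snd)

theorem integral_walshPair_mul {i j : ℕ+ × ℕ+} (h : i ≠ j) :
    ∫ p in unitSquare, walshPair i p * walshPair j p = 0 := by
  have e : ∀ p : ℝ × ℝ, walshPair i p * walshPair j p =
      (walsh i.1 p.1 * walsh j.1 p.1) * (walsh i.2 p.2 * walsh j.2 p.2) := by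
    intro p; unfold walshPair; ring
  simp only [e]
  rw [volume_restrict_unitSquare,
    integral_prod_mul (fun x => walsh i.1 x * walsh j.1 x) fun y => walsh i.2 y * walsh j.2 y]
  by_cases h1 : i.1 = j.1
  · have h2 : i.2 ≠ j.2 := fun h2 => h (Prod.ext h1 h2)
    rw [integral_walsh_mul (m := i.2) fun h' => h2 (PNat.eq h'), mul_zero]
  · rw [integral_walsh_mul (m := i.1) fun h' => h1 (PNat.eq h'), zero_mul]

theorem integrable_walshPair_mul (i j : ℕ+ × ℕ+) :
    Integrable (fun p => walshPair i p * walshPair j p) (volume.restrict unitSquare) := by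
  refine Integrable.of_bound
    ((measurable_walshPair i).mul (measurable_walshPair j)).aestronglyMeasurable 1
    (ae_of_all _ fun p => ?_)
  rw [Real.norm_eq_abs, abs_mul, abs_walshPair, abs_walshPair, one_mul]

theorem sq_sum_walshPair (G : Finset (ℕ+ × ℕ+)) (c : ℕ+ × ℕ+ → ℝ) (p : ℝ × ℝ) :
    (∑ i ∈ G, c i * walshPair i p) ^ 2 =
      ∑ i ∈ G, ∑ j ∈ G, c i * c j * (walshPair i p * walshPair j p) := by
  rw [sq, Finset.sum_mul_sum]
  exact Finset.sum_congr rfl fun i _ => Finset.sum_congr rfl fun j _ => by ring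

theorem integrable_sq_sum_walshPair (G : Finset (ℕ+ × ℕ+)) (c : ℕ+ × ℕ+ → ℝ) :
    Integrable (fun p => (∑ i ∈ G, c i * walshPair i p) ^ 2) (volume.restrict unitSquare) := by
  simp only [sq_sum_walshPair]
  exact integrable_finsetSum _ fun i _ => integrable_finsetSum _ fun j _ =>
    (integrable_walshPair_mul i j).const_mul _

theorem integral_sq_sum_walshPair (G : Finset (ℕ+ × ℕ+)) (c : ℕ+ × ℕ+ → ℝ) :
    ∫ p in unitSquare, (∑ i ∈ G, c i * walshPair i p) ^ 2 = ∑ i ∈ G, c i ^ 2 := by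
  simp only [sq_sum_walshPair]
  rw [integral_finsetSum _ fun i _ => integrable_finsetSum _ fun j _ =>
    (integrable_walshPair_mul i j).const_mul _]
  refine Finset.sum_congr rfl fun i hi => ?_
  rw [integral_finsetSum _ fun j _ => (integrable_walshPair_mul i j).const_mul _,
    Finset.sum_eq_single i]
  · simp [walshPair_mul_self, sq]
  · intro j _ hj
    rw [integral_const_mul, integral_walshPair_mul hj.symm, mul_zero]
  · exact fun h => absurd hi h

theorem integrable_abs_sum_walshPair (G : Finset (ℕ+ × ℕ+)) (c : ℕ+ × ℕ+ → ℝ) :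
    Integrable (fun p => |∑ i ∈ G, c i * walshPair i p|) (volume.restrict unitSquare) := by
  refine Integrable.abs (integrable_finsetSum _ fun i _ => Integrable.const_mul ?_ _)
  exact Integrable.of_bound (measurable_walshPair i).aestronglyMeasurable 1
    (ae_of_all _ fun p => (abs_walshPair i p).le)

/-- The `L¹` norm of a Walsh polynomial on the unit square is at most its `L²` norm. -/
theorem integral_abs_sum_walshPair_le (G : Finset (ℕ+ × ℕ+)) (c : ℕ+ × ℕ+ → ℝ) {δ : ℝ}
    (hδ : 0 < δ) (h : ∑ i ∈ G, c i ^ 2 ≤ δ ^ 2) :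
    ∫ p in unitSquare, |∑ i ∈ G, c i * walshPair i p| ≤ δ := by
  -- pointwise `2 |t| ≤ δ + t² / δ`, then orthogonality
  have hint : Integrable (fun p => δ / 2 + (2 * δ)⁻¹ * (∑ i ∈ G, c i * walshPair i p) ^ 2)
      (volume.restrict unitSquare) :=
    (integrable_const _).add ((integrable_sq_sum_walshPair G c).const_mul _)
  have hle := integral_mono (integrable_abs_sum_walshPair G c) hint fun p => by
    change |∑ i ∈ G, c i * walshPair i p| ≤
      δ / 2 + (2 * δ)⁻¹ * (∑ i ∈ G, c i * walshPair i p) ^ 2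
    set t := ∑ i ∈ G, c i * walshPair i p
    have : δ / 2 + (2 * δ)⁻¹ * t ^ 2 - |t| = (2 * δ)⁻¹ * (|t| - δ) ^ 2 := by
      rw [← sq_abs t]; field_simp; ring
    have : 0 ≤ (2 * δ)⁻¹ * (|t| - δ) ^ 2 := by positivity
    linarith
  refine hle.trans ?_
  rw [integral_add (integrable_const _) ((integrable_sq_sum_walshPair G c).const_mul _),
    integral_const_mul, integral_sq_sum_walshPair]
  simp only [integral_const, probReal_univ, smul_eq_mul, one_mul]
  have : (2 * δ)⁻¹ * ∑ i ∈ G, c i ^ 2 ≤ (2 * δ)⁻¹ * δ ^ 2 := by gcongr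
  have e : (2 * δ)⁻¹ * δ ^ 2 = δ / 2 := by field_simp
  linarith

/-! ### Modified indicators of dyadic cells -/

/-- The indicator of a cylinder, corrected on a small subcylinder so that every Walsh coefficient
without a frequency in `U` vanishes (for `U` disjoint from `D`). -/
noncomputable def modifiedIndicator (D U A : Finset ℕ) (x : ℝ) : ℝ :=
  (cylinderSet D A).indicator 1 x - 2 ^ U.card * (cylinderSet (D ∪ U) A).indicator 1 x

/-- The Walsh spectrum of `modifiedIndicator D U A`. -/
def modifiedSpectrum (D U : Finset ℕ) : Finset ℕ+ :=
  ((D ∪ U).powerset \ D.powerset).image fun S => (∑ s ∈ S, 2 ^ s).toPNat'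

theorem two_pow_le_sum_of_mem {S : Finset ℕ} {s : ℕ} (h : s ∈ S) : 2 ^ s ≤ ∑ s ∈ S, 2 ^ s :=
  Finset.single_le_sum (f := fun s => 2 ^ s) (fun _ _ => Nat.zero_le _) h

theorem exists_mem_of_mem_powerset_sdiff {D U S : Finset ℕ}
    (hS : S ∈ (D ∪ U).powerset \ D.powerset) : ∃ s ∈ S, s ∈ U := by
  simp only [Finset.mem_sdiff, Finset.mem_powerset] at hS
  obtain ⟨s, hs, hD⟩ := Finset.not_subset.1 hS.2
  exact ⟨s, hs, (Finset.mem_union.1 (hS.1 hs)).resolve_left hD⟩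

theorem coe_toPNat_sum_two_pow {D U S : Finset ℕ}
    (hS : S ∈ (D ∪ U).powerset \ D.powerset) :
    (((∑ s ∈ S, 2 ^ s).toPNat' : ℕ+) : ℕ) = ∑ s ∈ S, 2 ^ s := by
  obtain ⟨s, hs, -⟩ := exists_mem_of_mem_powerset_sdiff hS
  rw [Nat.toPNat'_coe, if_pos ((Nat.two_pow_pos s).trans_le (two_pow_le_sum_of_mem hs))]

theorem sum_modifiedSpectrum (D U : Finset ℕ) (f : ℕ+ → ℝ) :
    ∑ n ∈ modifiedSpectrum D U, f n =
      ∑ S ∈ (D ∪ U).powerset \ D.powerset, f (∑ s ∈ S, 2 ^ s).toPNat' := by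
  refine Finset.sum_image fun S hS S' hS' h => sum_two_pow_injective ?_
  change ∑ s ∈ S, 2 ^ s = ∑ s ∈ S', 2 ^ s
  rw [← coe_toPNat_sum_two_pow hS, ← coe_toPNat_sum_two_pow hS', h]

theorem card_modifiedSpectrum_le (D U : Finset ℕ) :
    (modifiedSpectrum D U).card ≤ 2 ^ (D.card + U.card) := by
  refine Finset.card_image_le.trans ((Finset.card_le_card Finset.sdiff_subset).trans ?_)
  rw [Finset.card_powerset]
  exact Nat.pow_le_pow_right two_pos (Finset.card_union_le D U)

theorem two_pow_le_of_mem_modifiedSpectrum {D U : Finset ℕ} {ν : ℕ} (hU : ∀ u ∈ U, ν ≤ u) {n : ℕ+}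
    (hn : n ∈ modifiedSpectrum D U) : 2 ^ ν ≤ (n : ℕ) := by
  obtain ⟨S, hS, rfl⟩ := Finset.mem_image.1 hn
  obtain ⟨s, hs, hsU⟩ := exists_mem_of_mem_powerset_sdiff hS
  rw [coe_toPNat_sum_two_pow hS]
  exact (Nat.pow_le_pow_right two_pos (hU s hsU)).trans (two_pow_le_sum_of_mem hs)

/-- The coefficient of `W_n` in `modifiedIndicator D U A`, for `n ∈ modifiedSpectrum D U`. -/
noncomputable def modifiedCoeff (D A : Finset ℕ) (n : ℕ) : ℝ :=
  -(2 ^ D.card)⁻¹ * ∏ s ∈ n.bitIndices.toFinset, patternSign A s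

theorem abs_modifiedCoeff (D A : Finset ℕ) (n : ℕ) : |modifiedCoeff D A n| = (2 ^ D.card)⁻¹ := by
  rw [modifiedCoeff, abs_mul, abs_prod_patternSign, mul_one, abs_neg, abs_of_pos (by positivity)]

theorem modifiedIndicator_eq_sum {D U : Finset ℕ} (h : Disjoint D U) (A : Finset ℕ) (x : ℝ) :
    modifiedIndicator D U A x = ∑ n ∈ modifiedSpectrum D U, modifiedCoeff D A n * walsh n x := by
  have h1 : ∑ n ∈ modifiedSpectrum D U, modifiedCoeff D A n * walsh n x =
      -(2 ^ D.card)⁻¹ * ∑ S ∈ (D ∪ U).powerset \ D.powerset,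
        (∏ s ∈ S, patternSign A s) * rademacherProd S x := by
    rw [sum_modifiedSpectrum D U fun n => modifiedCoeff D A n * walsh n x, Finset.mul_sum]
    refine Finset.sum_congr rfl fun S hS => ?_
    rw [coe_toPNat_sum_two_pow hS, walsh_sum_two_pow, modifiedCoeff,
      Finset.toFinset_bitIndices_sum_two_pow, mul_assoc]
  rw [h1, Finset.sum_sdiff_eq_sub (Finset.powerset_mono.2 Finset.subset_union_left),
    sum_patternSign_mul_rademacherProd, sum_patternSign_mul_rademacherProd,
    Finset.card_union_of_disjoint h, modifiedIndicator, pow_add]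
  field_simp
  ring

theorem modifiedIndicator_of_notMem {D U A : Finset ℕ} {x : ℝ} (hx : x ∉ cylinderSet (D ∪ U) A) :
    modifiedIndicator D U A x = (cylinderSet D A).indicator 1 x := by
  rw [modifiedIndicator, Set.indicator_of_notMem hx, mul_zero, sub_zero]

theorem modifiedIndicator_eq_zero {D U A : Finset ℕ} {x : ℝ} (hx : x ∉ cylinderSet D A) :
    modifiedIndicator D U A x = 0 := by
  rw [modifiedIndicator_of_notMem fun h => hx (cylinderSet_anti Finset.subset_union_left A h),
    Set.indicator_of_notMem hx]

/-- The indicator of the dyadic cell of level `P` with sign patterns `Q.1` and `Q.2`. -/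
noncomputable def cellIndicator (P : ℕ) (Q : Finset ℕ × Finset ℕ) (p : ℝ × ℝ) : ℝ :=
  (cylinderSet (Finset.range P) Q.1).indicator 1 p.1 *
    (cylinderSet (Finset.range P) Q.2).indicator 1 p.2

theorem cellIndicator_nonneg (P : ℕ) (Q : Finset ℕ × Finset ℕ) (p : ℝ × ℝ) :
    0 ≤ cellIndicator P Q p :=
  mul_nonneg (Set.indicator_nonneg (fun _ _ => zero_le_one) _)
    (Set.indicator_nonneg (fun _ _ => zero_le_one) _)

/-! ### Walsh polynomials with ordered terms -/

/-- The Walsh polynomial with a given list of terms, each an index with its coefficient. -/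
noncomputable def walshPoly (L : List ((ℕ+ × ℕ+) × ℝ)) (p : ℝ × ℝ) : ℝ :=
  (L.map fun t => t.2 * walshPair t.1 p).sum

theorem walshPoly_append (L L' : List ((ℕ+ × ℕ+) × ℝ)) (p : ℝ × ℝ) :
    walshPoly (L ++ L') p = walshPoly L p + walshPoly L' p := by
  simp [walshPoly]

theorem walshPoly_map_toList (F : Finset (ℕ+ × ℕ+)) (c : ℕ+ × ℕ+ → ℝ) (p : ℝ × ℝ) :
    walshPoly (F.toList.map fun i => (i, c i)) p = ∑ i ∈ F, c i * walshPair i p := by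
  rw [walshPoly, List.map_map, ← Finset.sum_map_toList]
  rfl

/-- A Walsh polynomial with large frequencies and small coefficients that agrees with a multiple of
the indicator of a dyadic cell off a small part of that cell. -/
theorem exists_walshPoly_cell (P a N : ℕ) (Q : Finset ℕ × Finset ℕ) (v V δ : ℝ) (hδ : 0 < δ)
    (hv : |v| ≤ V) (hV : V ^ 2 * 4 ^ a / 4 ^ P ≤ δ ^ 2) :
    ∃ (L : List ((ℕ+ × ℕ+) × ℝ)) (B : Set (ℝ × ℝ)),
      (L.map Prod.fst).Nodup ∧
      (∀ t ∈ L, N < t.1.1) ∧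
      (∀ t ∈ L, |t.2| ≤ V / 4 ^ P) ∧
      (L.map fun t => t.2 ^ 2).sum ≤ V ^ 2 * 4 ^ a / 4 ^ P ∧
      MeasurableSet B ∧
      volume.restrict unitSquare B ≤ ENNReal.ofReal (2 / (4 ^ P * 2 ^ a)) ∧
      (∀ p ∉ B, walshPoly L p = v * cellIndicator P Q p) ∧
      ∀ k, Integrable (fun p => |walshPoly (L.take k) p|) (volume.restrict unitSquare) ∧
        ∫ p in unitSquare, |walshPoly (L.take k) p| ≤ δ := by
  set D := Finset.range P with hD
  set ν := max N P
  set U := Finset.Ico ν (ν + a) with hU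
  have hDU : Disjoint D U := by
    rw [Finset.disjoint_left]
    intro s hs hs'
    simp only [hD, hU, Finset.mem_range, Finset.mem_Ico] at hs hs'
    have := le_max_right N P
    omega
  have hDc : D.card = P := Finset.card_range P
  have hUc : U.card = a := by simp [hU]
  set F := modifiedSpectrum D U ×ˢ modifiedSpectrum D U with hF
  set c : ℕ+ × ℕ+ → ℝ := fun i => v * modifiedCoeff D Q.1 i.1 * modifiedCoeff D Q.2 i.2 with hc
  have hcabs : ∀ i, |c i| = |v| / 4 ^ P := by
    intro i
    rw [hc]
    simp only [abs_mul, abs_modifiedCoeff, hDc]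
    rw [show (4 : ℝ) = 2 * 2 by norm_num, mul_pow]
    field_simp
  have hcle : ∀ i, |c i| ≤ V / 4 ^ P := fun i => by rw [hcabs]; gcongr
  have hcsq : ∀ G ⊆ F, ∑ i ∈ G, c i ^ 2 ≤ V ^ 2 * 4 ^ a / 4 ^ P := by
    intro G hG
    have hcard : (F.card : ℝ) ≤ 4 ^ (P + a) := by
      have h1 := card_modifiedSpectrum_le D U
      rw [hDc, hUc] at h1
      have h2 : F.card ≤ 2 ^ (P + a) * 2 ^ (P + a) := by
        rw [hF, Finset.card_product]; exact Nat.mul_le_mul h1 h1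
      rw [← mul_pow] at h2
      exact_mod_cast h2
    calc ∑ i ∈ G, c i ^ 2 ≤ ∑ i ∈ F, c i ^ 2 :=
          Finset.sum_le_sum_of_subset_of_nonneg hG fun _ _ _ => sq_nonneg _
      _ ≤ ∑ i ∈ F, (V / 4 ^ P) ^ 2 := by
          refine Finset.sum_le_sum fun i _ => ?_
          rw [← sq_abs]
          gcongr
          exact hcle i
      _ = F.card * (V / 4 ^ P) ^ 2 := by rw [Finset.sum_const, nsmul_eq_mul]
      _ ≤ 4 ^ (P + a) * (V / 4 ^ P) ^ 2 := by gcongr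
      _ = V ^ 2 * 4 ^ a / 4 ^ P := by rw [pow_add]; field_simp
  set L := F.toList.map fun i => (i, c i) with hL
  have hmem : ∀ t ∈ L, t.1 ∈ F ∧ t.2 = c t.1 := by
    intro t ht
    obtain ⟨i, hi, rfl⟩ := List.mem_map.1 ht
    exact ⟨Finset.mem_toList.1 hi, rfl⟩
  set B : Set (ℝ × ℝ) := (cylinderSet (D ∪ U) Q.1 ×ˢ cylinderSet D Q.2) ∪
    (cylinderSet D Q.1 ×ˢ cylinderSet (D ∪ U) Q.2) with hB
  refine ⟨L, B, ?_, ?_, ?_, ?_, ?_, ?_, ?_, ?_⟩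
  · have : L.map Prod.fst = F.toList := by
      rw [hL, List.map_map]
      exact List.map_id _
    rw [this]
    exact F.nodup_toList
  · intro t ht
    have h1 := (Finset.mem_product.1 (hmem t ht).1).1
    have h2 := two_pow_le_of_mem_modifiedSpectrum (ν := ν)
      (fun u hu => (Finset.mem_Ico.1 hu).1) h1
    exact ((le_max_left N P).trans_lt Nat.lt_two_pow_self).trans_le h2
  · intro t ht
    rw [(hmem t ht).2]
    exact hcle _
  · rw [hL, List.map_map]
    change (F.toList.map fun i => c i ^ 2).sum ≤ _
    rw [Finset.sum_map_toList]
    exact hcsq F subset_rfl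
  · exact ((measurableSet_cylinderSet _ _).prod (measurableSet_cylinderSet _ _)).union
      ((measurableSet_cylinderSet _ _).prod (measurableSet_cylinderSet _ _))
  · refine (measure_union_le _ _).trans ?_
    rw [volume_restrict_unitSquare, Measure.prod_prod, Measure.prod_prod]
    simp only [measure_cylinderSet, Finset.card_union_of_disjoint hDU, hDc, hUc]
    rw [← ENNReal.ofReal_mul (by positivity), ← ENNReal.ofReal_mul (by positivity),
      ← ENNReal.ofReal_add (by positivity) (by positivity)]
    refine ENNReal.ofReal_le_ofReal (le_of_eq ?_)
    rw [show (4 : ℝ) = 2 * 2 by norm_num, mul_pow, pow_add]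
    field_simp
    ring
  · intro p hp
    have h1 : walshPoly L p =
        v * (modifiedIndicator D U Q.1 p.1 * modifiedIndicator D U Q.2 p.2) := by
      rw [hL, walshPoly_map_toList, modifiedIndicator_eq_sum hDU, modifiedIndicator_eq_sum hDU,
        Finset.sum_mul_sum, ← Finset.sum_product', Finset.mul_sum]
      refine Finset.sum_congr rfl fun i _ => ?_
      simp only [hc, walshPair]
      ring
    rw [h1, cellIndicator]
    congr 1
    by_cases hx : p.1 ∈ cylinderSet D Q.1
    · by_cases hy : p.2 ∈ cylinderSet D Q.2
      · rw [modifiedIndicator_of_notMem fun h => hp (Or.inl ⟨h, hy⟩),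
          modifiedIndicator_of_notMem fun h => hp (Or.inr ⟨hx, h⟩)]
      · rw [modifiedIndicator_eq_zero hy, Set.indicator_of_notMem hy, mul_zero, mul_zero]
    · rw [modifiedIndicator_eq_zero hx, Set.indicator_of_notMem hx, zero_mul, zero_mul]
  · intro k
    have hG : ∀ p, walshPoly (L.take k) p = ∑ i ∈ (F.toList.take k).toFinset, c i * walshPair i p := by
      intro p
      rw [hL, ← List.map_take, walshPoly, List.map_map,
        List.sum_toFinset _ (F.nodup_toList.sublist (List.take_sublist _ _))]
      rfl
    simp only [hG]
    refine ⟨integrable_abs_sum_walshPair _ c, integral_abs_sum_walshPair_le _ c hδ ?_⟩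
    refine (hcsq _ fun i hi => ?_).trans hV
    rw [List.mem_toFinset] at hi
    exact Finset.mem_toList.1 (List.mem_of_mem_take hi)

/-- The polynomials of the cells in the list `C`, put one after another with disjoint spectra. Since
complete cells contribute exact values off `B`, the error of a partial sum comes from one cell
only and does not accumulate. -/
theorem exists_walshPoly_cells (P a : ℕ) (V δ : ℝ) (hδ : 0 < δ)
    (hV : V ^ 2 * 4 ^ a / 4 ^ P ≤ δ ^ 2) (C : List ((Finset ℕ × Finset ℕ) × ℝ)) :
    (∀ q ∈ C, |q.2| ≤ V) → ∀ N : ℕ,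
    ∃ (L : List ((ℕ+ × ℕ+) × ℝ)) (B : Set (ℝ × ℝ)),
      (L.map Prod.fst).Nodup ∧
      (∀ t ∈ L, N < t.1.1) ∧
      (∀ t ∈ L, |t.2| ≤ V / 4 ^ P) ∧
      (L.map fun t => t.2 ^ 2).sum ≤ C.length * (V ^ 2 * 4 ^ a / 4 ^ P) ∧
      MeasurableSet B ∧
      volume.restrict unitSquare B ≤ C.length * ENNReal.ofReal (2 / (4 ^ P * 2 ^ a)) ∧
      (∀ p ∉ B, walshPoly L p = (C.map fun q => q.2 * cellIndicator P q.1 p).sum) ∧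
      ∀ k, ∃ R : ℝ × ℝ → ℝ, (∀ p, 0 ≤ R p) ∧ Integrable R (volume.restrict unitSquare) ∧
        ∫ p in unitSquare, R p ≤ δ ∧
        ∀ p ∉ B, |walshPoly (L.take k) p| ≤
          (C.map fun q => |q.2| * cellIndicator P q.1 p).sum + R p := by
  induction C with
  | nil =>
    intro _ N
    refine ⟨[], ∅, by simp, by simp, by simp, by simp, MeasurableSet.empty, by simp,
      by simp [walshPoly], fun k => ⟨0, fun _ => le_rfl, integrable_zero _ _ _, ?_, ?_⟩⟩
    · simpa using hδ.le
    · simp [walshPoly]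
  | cons q C ih =>
    intro hC N
    obtain ⟨L₁, B₁, nd₁, lo₁, co₁, sq₁, me₁, vo₁, su₁, pr₁⟩ :=
      exists_walshPoly_cell P a N q.1 q.2 V δ hδ (hC q (by simp)) hV
    -- the frequencies of the remaining cells are taken above those of the first one
    set N' := N + (L₁.map fun t => (t.1.1 : ℕ)).sum
    have hN' : ∀ t ∈ L₁, (t.1.1 : ℕ) ≤ N' := fun t ht =>
      (List.le_sum_of_mem (List.mem_map_of_mem (f := fun t => (t.1.1 : ℕ)) ht)).trans
        (Nat.le_add_left _ _)
    obtain ⟨L₂, B₂, nd₂, lo₂, co₂, sq₂, me₂, vo₂, su₂, pr₂⟩ :=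
      ih (fun q hq => hC q (List.mem_cons_of_mem _ hq)) N'
    refine ⟨L₁ ++ L₂, B₁ ∪ B₂, ?_, ?_, ?_, ?_, me₁.union me₂, ?_, ?_, ?_⟩
    · rw [List.map_append, List.nodup_append]
      refine ⟨nd₁, nd₂, ?_⟩
      rintro i hi j hj rfl
      obtain ⟨t, ht, rfl⟩ := List.mem_map.1 hi
      obtain ⟨t', ht', e⟩ := List.mem_map.1 hj
      have h1 := hN' t ht
      have h2 := lo₂ t' ht'
      rw [e] at h2
      omega
    · intro t ht
      rcases List.mem_append.1 ht with h | h
      · exact lo₁ t h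
      · exact (Nat.le_add_right _ _).trans_lt (lo₂ t h)
    · intro t ht
      rcases List.mem_append.1 ht with h | h
      · exact co₁ t h
      · exact co₂ t h
    · rw [List.map_append, List.sum_append, List.length_cons]
      push_cast
      linarith
    · refine (measure_union_le _ _).trans ((add_le_add vo₁ vo₂).trans (le_of_eq ?_))
      rw [List.length_cons]
      push_cast
      ring
    · intro p hp
      rw [Set.mem_union, not_or] at hp
      rw [walshPoly_append, su₁ p hp.1, su₂ p hp.2, List.map_cons, List.sum_cons]
    · intro k
      rcases le_total k L₁.length with hk | hk
      · refine ⟨fun p => |walshPoly (L₁.take k) p|, fun _ => abs_nonneg _, (pr₁ k).1, (pr₁ k).2, ?_⟩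
        intro p _
        rw [List.take_append_of_le_length hk]
        refine le_add_of_nonneg_left (List.sum_nonneg fun x hx => ?_)
        obtain ⟨q, -, rfl⟩ := List.mem_map.1 hx
        exact mul_nonneg (abs_nonneg _) (cellIndicator_nonneg _ _ _)
      · obtain ⟨R, R0, Ri, Rδ, hR⟩ := pr₂ (k - L₁.length)
        refine ⟨R, R0, Ri, Rδ, fun p hp => ?_⟩
        rw [Set.mem_union, not_or] at hp
        rw [List.take_append, List.take_of_length_le hk, walshPoly_append, su₁ p hp.1,
          List.map_cons, List.sum_cons]
        refine (abs_add_le _ _).trans ?_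
        rw [abs_mul, abs_of_nonneg (cellIndicator_nonneg _ _ _), add_assoc]
        exact add_le_add le_rfl (hR p hp.2)

/-! ### Dyadic step functions -/

/-- The set of `s < P` with `r_s(x) = -1`: the first `P` binary digits of `x`. -/
noncomputable def digitSet (P : ℕ) (x : ℝ) : Finset ℕ :=
  (Finset.range P).filter fun s => rademacher s x = -1

theorem digitSet_subset (P : ℕ) (x : ℝ) : digitSet P x ⊆ Finset.range P := Finset.filter_subset _ _

theorem digitSet_inter_range {P P' : ℕ} (h : P ≤ P') (x : ℝ) :
    digitSet P' x ∩ Finset.range P = digitSet P x := by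
  ext s
  simp only [digitSet, Finset.mem_inter, Finset.mem_filter, Finset.mem_range]
  constructor
  · rintro ⟨⟨-, h1⟩, h2⟩; exact ⟨h2, h1⟩
  · rintro ⟨h1, h2⟩; exact ⟨⟨h1.trans_le h, h2⟩, h1⟩

theorem mem_cylinderSet_range_iff {P : ℕ} {A : Finset ℕ} (hA : A ⊆ Finset.range P) (x : ℝ) :
    x ∈ cylinderSet (Finset.range P) A ↔ digitSet P x = A := by
  constructor
  · intro hx
    ext s
    simp only [digitSet, Finset.mem_filter]
    constructor
    · rintro ⟨h1, h2⟩
      have h3 := hx s h1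
      rw [h2, patternSign] at h3
      by_contra hs
      rw [if_neg hs] at h3
      norm_num at h3
    · intro hs
      refine ⟨hA hs, ?_⟩
      rw [hx s (hA hs), patternSign, if_pos hs]
  · rintro rfl s hs
    unfold patternSign
    rcases rademacher_eq_or s x with h | h
    · rw [if_neg, h]
      intro hs'
      rw [(Finset.mem_filter.1 hs').2] at h
      norm_num at h
    · rw [if_pos, h]
      exact Finset.mem_filter.2 ⟨hs, h⟩

theorem cellIndicator_eq {P : ℕ} {Q : Finset ℕ × Finset ℕ}
    (hQ : Q ∈ (Finset.range P).powerset ×ˢ (Finset.range P).powerset) (p : ℝ × ℝ) :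
    cellIndicator P Q p = if Q = (digitSet P p.1, digitSet P p.2) then 1 else 0 := by
  classical
  rw [Finset.mem_product, Finset.mem_powerset, Finset.mem_powerset] at hQ
  unfold cellIndicator
  rw [Set.indicator_apply, Set.indicator_apply, mem_cylinderSet_range_iff hQ.1,
    mem_cylinderSet_range_iff hQ.2, Pi.one_apply, Pi.one_apply]
  simp only [Prod.ext_iff, eq_comm (a := Q.1), eq_comm (a := Q.2)]
  split_ifs <;> simp_all

theorem sum_mul_cellIndicator (P : ℕ) (v : Finset ℕ × Finset ℕ → ℝ) (p : ℝ × ℝ) :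
    ∑ Q ∈ (Finset.range P).powerset ×ˢ (Finset.range P).powerset, v Q * cellIndicator P Q p =
      v (digitSet P p.1, digitSet P p.2) := by
  rw [Finset.sum_eq_single (digitSet P p.1, digitSet P p.2)]
  · rw [cellIndicator_eq, if_pos rfl, mul_one]
    simp [digitSet_subset]
  · intro Q hQ hne
    rw [cellIndicator_eq hQ, if_neg hne, mul_zero]
  · intro h
    exact absurd (by simp [digitSet_subset]) h

/-- The code of a dyadic step function: its level and its values on the cells of that level. -/
abbrev StepCode := ℕ × ((Finset ℕ × Finset ℕ) →₀ ℚ)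

/-- The dyadic step function with a given code. -/
noncomputable def dyadicStep (t : StepCode) (p : ℝ × ℝ) : ℝ :=
  (t.2 (digitSet t.1 p.1, digitSet t.1 p.2) : ℝ)

/-- A step function on a finer grid; `φ` covers both the function and its absolute value. -/
theorem dyadicStep_eq_sum (t : StepCode) {P : ℕ} (hP : t.1 ≤ P) (φ : ℝ → ℝ) (p : ℝ × ℝ) :
    φ (dyadicStep t p) = ∑ Q ∈ (Finset.range P).powerset ×ˢ (Finset.range P).powerset,
      φ (t.2 (Q.1 ∩ Finset.range t.1, Q.2 ∩ Finset.range t.1)) * cellIndicator P Q p := by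
  rw [sum_mul_cellIndicator P
      (fun Q => φ (t.2 (Q.1 ∩ Finset.range t.1, Q.2 ∩ Finset.range t.1))),
    digitSet_inter_range hP, digitSet_inter_range hP]
  rfl

theorem exists_abs_stepCode_le (t : StepCode) : ∃ V : ℝ, 0 ≤ V ∧ ∀ Q, |(t.2 Q : ℝ)| ≤ V := by
  refine ⟨∑ Q ∈ t.2.support, |(t.2 Q : ℝ)|, Finset.sum_nonneg fun _ _ => abs_nonneg _, fun Q => ?_⟩
  by_cases hQ : Q ∈ t.2.support
  · exact Finset.single_le_sum (f := fun Q => |(t.2 Q : ℝ)|) (fun _ _ => abs_nonneg _) hQ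
  · rw [Finsupp.notMem_support_iff.1 hQ, Rat.cast_zero, abs_zero]
    exact Finset.sum_nonneg fun _ _ => abs_nonneg _

theorem measurable_dyadicStep (t : StepCode) : Measurable (dyadicStep t) := by
  have : dyadicStep t = fun p => ∑ Q ∈ (Finset.range t.1).powerset ×ˢ (Finset.range t.1).powerset,
      id (t.2 (Q.1 ∩ Finset.range t.1, Q.2 ∩ Finset.range t.1) : ℝ) * cellIndicator t.1 Q p :=
    funext fun p => dyadicStep_eq_sum t le_rfl id p
  rw [this]
  refine Finset.measurable_sum _ fun Q _ => Measurable.const_mul ?_ _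
  exact ((measurable_one.indicator (measurableSet_cylinderSet _ _)).comp measurable_fst).mul
    ((measurable_one.indicator (measurableSet_cylinderSet _ _)).comp measurable_snd)

/-! ### Walsh polynomials approximating a step function -/

/-- `L` lists the terms of a Walsh polynomial with frequencies above `N` that equals `g` off the
small set `B`, whose coefficients are small in `ℓ^(2+δ)`, and whose partial sums are, off `B`,
dominated by `|g|` up to an error that is small in `L¹`. -/
structure IsWalshBlock (g : ℝ × ℝ → ℝ) (δ : ℝ) (N : ℕ) (L : List ((ℕ+ × ℕ+) × ℝ))
    (B : Set (ℝ × ℝ)) : Prop where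
  nodup : (L.map Prod.fst).Nodup
  lt_fst : ∀ t ∈ L, N < t.1.1
  sum_rpow_le : (L.map fun t => |t.2| ^ (2 + δ)).sum ≤ δ
  measurableSet : MeasurableSet B
  measure_le : volume.restrict unitSquare B ≤ ENNReal.ofReal δ
  eq_off : ∀ p ∉ B, walshPoly L p = g p
  prefix_le : ∀ k, ∃ R : ℝ × ℝ → ℝ, (∀ p, 0 ≤ R p) ∧ Integrable R (volume.restrict unitSquare) ∧
    ∫ p in unitSquare, R p ≤ δ ∧ ∀ p ∉ B, |walshPoly (L.take k) p| ≤ |g p| + R p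

/-- A step function is written on a finer and finer dyadic grid: the sum of squares of the
coefficients of the polynomials attached to the cells stays bounded, while the coefficients and the
polynomial of each single cell tend to zero. -/
theorem exists_isWalshBlock (t : StepCode) {δ : ℝ} (hδ : 0 < δ) (N : ℕ) :
    ∃ L B, IsWalshBlock (dyadicStep t) δ N L B := by
  obtain ⟨V, hV0, hV⟩ := exists_abs_stepCode_le t
  obtain ⟨a, ha⟩ : ∃ a : ℕ, 2 * (1 / 2 : ℝ) ^ a < δ := by
    obtain ⟨a, ha⟩ := exists_pow_lt_of_lt_one (half_pos hδ) (by norm_num : (1 / 2 : ℝ) < 1)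
    exact ⟨a, by linarith⟩
  set K := V ^ 2 * 4 ^ a with hK
  have hpow : Tendsto (fun P : ℕ => (4 ^ P : ℝ)) atTop atTop :=
    tendsto_pow_atTop_atTop_of_one_lt (by norm_num)
  have h1 : Tendsto (fun P : ℕ => K / 4 ^ P) atTop (𝓝 0) := tendsto_const_nhds.div_atTop hpow
  have h2 : Tendsto (fun P : ℕ => (V / 4 ^ P) ^ δ * K) atTop (𝓝 0) := by
    have h3 : Tendsto (fun P : ℕ => V / 4 ^ P) atTop (𝓝 0) := tendsto_const_nhds.div_atTop hpow
    have h4 := (h3.rpow_const (p := δ) (Or.inr hδ.le)).mul_const K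
    rwa [Real.zero_rpow hδ.ne', zero_mul] at h4
  obtain ⟨P, ⟨hP1, hP2⟩, hP⟩ := (((h1.eventually (gt_mem_nhds (by positivity : 0 < δ ^ 2))).and
    (h2.eventually (gt_mem_nhds hδ))).and (eventually_ge_atTop t.1)).exists
  set cells := (Finset.range P).powerset ×ˢ (Finset.range P).powerset with hcells
  set C : List ((Finset ℕ × Finset ℕ) × ℝ) := cells.toList.map fun Q =>
    (Q, (t.2 (Q.1 ∩ Finset.range t.1, Q.2 ∩ Finset.range t.1) : ℝ)) with hC
  have hCV : ∀ q ∈ C, |q.2| ≤ V := by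
    intro q hq
    obtain ⟨Q, -, rfl⟩ := List.mem_map.1 hq
    exact hV _
  have hlen : C.length = 4 ^ P := by
    rw [hC, List.length_map, Finset.length_toList, hcells, Finset.card_product,
      Finset.card_powerset, Finset.card_range, ← mul_pow]
    norm_num
  have hsum : ∀ (φ : ℝ → ℝ) p, (C.map fun q => φ q.2 * cellIndicator P q.1 p).sum =
      φ (dyadicStep t p) := by
    intro φ p
    rw [dyadicStep_eq_sum t hP φ p, hC, List.map_map, ← Finset.sum_map_toList]
    rfl
  obtain ⟨L, B, nd, lo, co, sq, me, vo, su, pr⟩ :=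
    exists_walshPoly_cells P a V δ hδ hP1.le C hCV N
  refine ⟨L, B, nd, lo, ?_, me, ?_, ?_, ?_⟩
  · have hle : (L.map fun t => |t.2| ^ (2 + δ)).sum ≤
        (L.map fun t => (V / 4 ^ P) ^ δ * t.2 ^ 2).sum := by
      refine List.sum_le_sum fun u hu => ?_
      rcases eq_or_ne u.2 0 with h0 | h0
      · rw [h0, abs_zero, Real.zero_rpow (by positivity)]
        positivity
      · rw [Real.rpow_add (abs_pos.2 h0), Real.rpow_two, sq_abs, mul_comm]
        gcongr
        exact co u hu
    refine hle.trans ?_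
    rw [List.sum_map_mul_left]
    have h3 : (L.map fun t => t.2 ^ 2).sum ≤ K := by
      refine sq.trans (le_of_eq ?_)
      rw [hlen, hK]
      push_cast
      field_simp
    exact (mul_le_mul_of_nonneg_left h3 (by positivity)).trans hP2.le
  · refine vo.trans ?_
    rw [hlen, ← ENNReal.ofReal_natCast, ← ENNReal.ofReal_mul (by positivity)]
    refine ENNReal.ofReal_le_ofReal ((le_of_eq ?_).trans ha.le)
    push_cast
    rw [div_pow, one_pow]
    field_simp
  · intro p hp
    rw [su p hp]
    exact hsum id p
  · intro k
    obtain ⟨R, R0, Ri, Rδ, hR⟩ := pr k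
    refine ⟨R, R0, Ri, Rδ, fun p hp => ?_⟩
    rw [← hsum (fun x => |x|) p]
    exact hR p hp

/-! ### Density of dyadic step functions -/

/-- The left end point of the dyadic interval with digit set `A`. -/
noncomputable def leftEndpoint (A : Finset ℕ) : ℝ := ∑ s ∈ A, (2 ^ (s + 1))⁻¹

/-- The first `P` binary digits of `x` determine `⌊2^P x⌋`. -/
theorem leftEndpoint_digitSet (P : ℕ) {x : ℝ} (h0 : 0 ≤ x) (h1 : x < 1) :
    leftEndpoint (digitSet P x) = ⌊2 ^ P * x⌋ / 2 ^ P := by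
  induction P with
  | zero =>
    have : ⌊x⌋ = 0 := Int.floor_eq_zero_iff.2 ⟨h0, h1⟩
    simp [leftEndpoint, digitSet, this]
  | succ P ih =>
    set y := 2 ^ P * x with hy
    have hf := Int.fract_add_floor y
    have hf0 := Int.fract_nonneg y
    have hf1 := Int.fract_lt_one y
    have hyy : 2 ^ (P + 1) * x = 2 * y := by rw [hy, pow_succ]; ring
    rw [hyy]
    unfold leftEndpoint digitSet at ih ⊢
    rw [Finset.sum_filter] at ih ⊢
    rw [Finset.sum_range_succ, ih]
    unfold rademacher
    rw [← hy]
    by_cases hlt : Int.fract y < 1 / 2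
    · have : ⌊2 * y⌋ = 2 * ⌊y⌋ := by
        rw [Int.floor_eq_iff]; push_cast; constructor <;> linarith
      rw [if_pos hlt, if_neg (by norm_num), this, pow_succ]
      push_cast
      field_simp
      ring
    · have : ⌊2 * y⌋ = 2 * ⌊y⌋ + 1 := by
        rw [Int.floor_eq_iff]; push_cast; constructor <;> linarith
      rw [if_neg hlt, if_pos rfl, this, pow_succ]
      push_cast
      field_simp

theorem abs_leftEndpoint_digitSet_sub_le (P : ℕ) {x : ℝ} (h0 : 0 ≤ x) (h1 : x < 1) :
    |leftEndpoint (digitSet P x) - x| ≤ (1 / 2) ^ P := by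
  have h2 : (0 : ℝ) < 2 ^ P := by positivity
  have e : leftEndpoint (digitSet P x) - x = -(Int.fract (2 ^ P * x) / 2 ^ P) := by
    rw [leftEndpoint_digitSet P h0 h1, ← Int.self_sub_floor]
    field_simp
    ring
  rw [e, abs_neg, abs_of_nonneg (div_nonneg (Int.fract_nonneg _) h2.le), one_div, inv_pow,
    div_eq_mul_inv]
  exact mul_le_of_le_one_left (by positivity) (Int.fract_lt_one _).le

/-- The right and upper edges, where the digits of `1` are those of `0`, are discarded. -/
theorem ae_unitSquare : ∀ᵐ p ∂((volume : Measure (ℝ × ℝ)).restrict unitSquare),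
    (0 ≤ p.1 ∧ p.1 < 1) ∧ 0 ≤ p.2 ∧ p.2 < 1 := by
  have h : ∀ᵐ x ∂((volume : Measure ℝ).restrict (Set.Icc 0 1)), 0 ≤ x ∧ x < 1 := by
    rw [← Measure.restrict_congr_set Ico_ae_eq_Icc]
    exact ae_restrict_mem measurableSet_Ico
  rw [volume_restrict_unitSquare]
  exact (Measure.quasiMeasurePreserving_fst.ae h).and (Measure.quasiMeasurePreserving_snd.ae h)

theorem exists_dyadicStep_near {g : ℝ × ℝ → ℝ} (hg : UniformContinuous g) {ε : ℝ} (hε : 0 < ε) :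
    ∃ t : StepCode, ∀ p : ℝ × ℝ, ((0 ≤ p.1 ∧ p.1 < 1) ∧ 0 ≤ p.2 ∧ p.2 < 1) →
      |g p - dyadicStep t p| ≤ ε := by
  obtain ⟨η, hη, hgη⟩ := Metric.uniformContinuous_iff.1 hg (ε / 2) (half_pos hε)
  obtain ⟨P, hP⟩ := exists_pow_lt_of_lt_one hη (by norm_num : (1 / 2 : ℝ) < 1)
  have hrat : ∀ Q : Finset ℕ × Finset ℕ, ∃ r : ℚ,
      |g (leftEndpoint Q.1, leftEndpoint Q.2) - r| < ε / 2 := fun Q =>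
    exists_rat_near _ (half_pos hε)
  choose r hr using hrat
  let cells := (Finset.range P).powerset ×ˢ (Finset.range P).powerset
  classical
  let v : (Finset ℕ × Finset ℕ) →₀ ℚ := Finsupp.onFinset cells
    (fun Q => if Q ∈ cells then r Q else 0) (fun Q h => by by_contra h'; simp [h'] at h)
  refine ⟨(P, v), fun p hp => ?_⟩
  set Q := (digitSet P p.1, digitSet P p.2) with hQ
  have hv : dyadicStep (P, v) p = r Q := by
    have hmem : Q ∈ cells := by simp [cells, hQ, digitSet_subset]
    have : v Q = r Q := by simp [v, hmem]
    exact congrArg _ this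
  have hd : dist p (leftEndpoint Q.1, leftEndpoint Q.2) < η := by
    rw [dist_comm, Prod.dist_eq]
    refine lt_of_le_of_lt (max_le ?_ ?_) hP
    · exact abs_leftEndpoint_digitSet_sub_le P hp.1.1 hp.1.2
    · exact abs_leftEndpoint_digitSet_sub_le P hp.2.1 hp.2.2
  have h1 := hgη hd
  rw [Real.dist_eq] at h1
  have h2 := hr Q
  rw [hv]
  have := abs_sub_le (g p) (g (leftEndpoint Q.1, leftEndpoint Q.2)) (r Q)
  linarith

theorem exists_integral_abs_sub_dyadicStep_le {lam : Measure (ℝ × ℝ)}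
    (hlam : lam ≤ volume.restrict unitSquare) {f : ℝ × ℝ → ℝ} (hf : Integrable f lam)
    {ε : ℝ} (hε : 0 < ε) :
    ∃ t : StepCode, Integrable (dyadicStep t) lam ∧ ∫ p, |f p - dyadicStep t p| ∂lam ≤ ε := by
  have : IsFiniteMeasure lam := isFiniteMeasure_of_le _ hlam
  obtain ⟨g, hgc, hfg, hgcont, hgint⟩ :=
    hf.exists_hasCompactSupport_integral_sub_le (half_pos hε)
  have hgu : UniformContinuous g := hgc.uniformContinuous_of_continuous hgcont
  obtain ⟨t, ht⟩ := exists_dyadicStep_near hgu (half_pos hε)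
  have hti : Integrable (dyadicStep t) lam := by
    obtain ⟨V, -, hV⟩ := exists_abs_stepCode_le t
    exact Integrable.of_bound (measurable_dyadicStep t).aestronglyMeasurable V
      (ae_of_all _ fun p => hV _)
  refine ⟨t, hti, ?_⟩
  have hae : ∀ᵐ p ∂lam, |g p - dyadicStep t p| ≤ ε / 2 :=
    (Measure.absolutelyContinuous_of_le hlam).ae_le (ae_unitSquare.mono ht)
  have hmass : lam.real Set.univ ≤ 1 := by
    have h1 : lam Set.univ ≤ 1 := (hlam Set.univ).trans prob_le_one
    exact ENNReal.toReal_le_of_le_ofReal zero_le_one (by simpa using h1)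
  have h2 : ∫ p, |g p - dyadicStep t p| ∂lam ≤ ε / 2 := by
    refine (integral_mono_ae (hgint.sub hti).abs (integrable_const (ε / 2)) hae).trans ?_
    rw [integral_const, smul_eq_mul]
    exact mul_le_of_le_one_left (half_pos hε).le hmass
  have h3 : ∫ p, |f p - dyadicStep t p| ∂lam ≤
      ∫ p, (|f p - g p| + |g p - dyadicStep t p|) ∂lam :=
    integral_mono (hf.sub hti).abs ((hf.sub hgint).abs.add (hgint.sub hti).abs)
      fun p => abs_sub_le _ _ _
  have h4 : ∫ p, (|f p - g p| + |g p - dyadicStep t p|) ∂lam =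
      ∫ p, |f p - g p| ∂lam + ∫ p, |g p - dyadicStep t p| ∂lam :=
    integral_add (hf.sub hgint).abs (hgint.sub hti).abs
  simp only [Real.norm_eq_abs] at hfg
  linarith

/-! ### Rearrangements of series in a normed group -/

/-- If every vector can be approximated by sums of finitely many fresh terms, with partial sums
not much larger than the vector, and the terms tend to zero, then the terms can be arranged into a
series converging to any prescribed vector: alternately place the first unused term and correct the
remaining error. -/
theorem exists_rearrangement_tendsto {ι E : Type*} [Countable ι] [Infinite ι]
    [NormedAddCommGroup E] (u : ι → E) (hu : Tendsto (fun i => ‖u i‖) cofinite (𝓝 0))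
    (H : ∀ (g : E) (F : Finset ι) (ε : ℝ), 0 < ε → ∃ L : List ι, L.Nodup ∧ (∀ i ∈ L, i ∉ F) ∧
      ‖(L.map u).sum - g‖ ≤ ε ∧ ∀ k, ‖((L.take k).map u).sum‖ ≤ ‖g‖ + ε)
    (f : E) :
    ∃ τ : ℕ ≃ ι, Tendsto (fun n => ∑ k ∈ Finset.range n, u (τ k)) atTop (𝓝 f) := by
  classical
  obtain ⟨en⟩ : Nonempty (ℕ ≃ ι) := ⟨(nonempty_denumerable ι).some.eqv.symm⟩
  have hfresh : ∀ l : List ι, ∃ m, en m ∉ l := by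
    intro l
    obtain ⟨i, hi⟩ := Infinite.exists_notMem_finset l.toFinset
    exact ⟨en.symm i, by simpa using hi⟩
  let first : List ι → ι := fun l => en (Nat.find (hfresh l))
  have hfirst : ∀ l, first l ∉ l := fun l => Nat.find_spec (hfresh l)
  choose cor cnd cfr cap cpr using fun (l : List ι) (n : ℕ) =>
    H (f - (l.map u).sum - u (first l)) (insert (first l) l.toFinset) ((1 / 2) ^ n) (by positivity)
  obtain ⟨S, hS0, hS⟩ : ∃ S : ℕ → List ι, S 0 = [] ∧
      ∀ n, S (n + 1) = S n ++ (first (S n) :: cor (S n) n) :=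
    ⟨fun n => Nat.rec [] (fun n l => l ++ (first l :: cor l n)) n, rfl, fun n => rfl⟩
  have hnd : ∀ n, (S n).Nodup := by
    intro n
    induction n with
    | zero => rw [hS0]; exact List.nodup_nil
    | succ n ih =>
      rw [hS, List.nodup_append, List.nodup_cons]
      refine ⟨ih, ⟨fun h => cfr _ _ _ h (Finset.mem_insert_self _ _), cnd _ _⟩, ?_⟩
      rintro i hi j hj rfl
      rcases List.mem_cons.1 hj with rfl | h
      · exact hfirst _ hi
      · exact cfr _ _ _ h (Finset.mem_insert_of_mem (List.mem_toFinset.2 hi))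
  have hpre : ∀ {m n}, m ≤ n → S m <+: S n := by
    intro m n hmn
    induction n, hmn using Nat.le_induction with
    | base => exact List.prefix_rfl
    | succ n _ ih => exact ih.trans ⟨_, (hS n).symm⟩
  have hlen : ∀ n, n ≤ (S n).length := by
    intro n
    induction n with
    | zero => exact Nat.zero_le _
    | succ n ih => rw [hS, List.length_append, List.length_cons]; omega
  have hcov : ∀ n m, m < n → en m ∈ S n := by
    intro n
    induction n with
    | zero => intro m hm; exact absurd hm (Nat.not_lt_zero _)
    | succ n ih =>
      intro m hm
      rw [hS]
      rcases Nat.lt_succ_iff_lt_or_eq.1 hm with h | h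
      · exact List.mem_append_left _ (ih m h)
      · rw [h]
        by_cases hin : en n ∈ S n
        · exact List.mem_append_left _ hin
        · refine List.mem_append_right _ (List.mem_cons.2 (Or.inl ?_))
          have : Nat.find (hfresh (S n)) = n :=
            (Nat.find_eq_iff _).2 ⟨hin, fun j hj => not_not.2 (ih j hj)⟩
          simp only [first, this]
  let τ : ℕ → ι := fun k => (S (k + 1))[k]'(hlen (k + 1))
  have hτ : ∀ n k (h : k < (S n).length), τ k = (S n)[k] := by
    intro n k h
    rcases le_total n (k + 1) with h' | h'
    · exact ((hpre h').getElem h).symm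
    · exact (hpre h').getElem (hlen (k + 1))
  have hinj : Function.Injective τ := by
    intro j k hjk
    have hl := hlen (max j k + 1)
    have hj : j < (S (max j k + 1)).length := by omega
    have hk : k < (S (max j k + 1)).length := by omega
    rw [hτ _ j hj, hτ _ k hk] at hjk
    exact (hnd _).getElem_inj_iff.1 hjk
  have hsurj : Function.Surjective τ := by
    intro i
    have h := hcov (en.symm i + 1) (en.symm i) (Nat.lt_succ_self _)
    rw [Equiv.apply_symm_apply] at h
    obtain ⟨k, hk, e⟩ := List.getElem_of_mem h
    exact ⟨k, (hτ (en.symm i + 1) k hk).trans e⟩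
  refine ⟨Equiv.ofBijective τ ⟨hinj, hsurj⟩, ?_⟩
  have hpart : ∀ n N, N ≤ (S n).length →
      ∑ k ∈ Finset.range N, u (τ k) = (((S n).take N).map u).sum := by
    intro n N hN
    induction N with
    | zero => simp
    | succ N ih =>
      rw [Finset.sum_range_succ, ih (by omega), List.take_succ_eq_append_getElem (by omega),
        List.map_append, List.sum_append, hτ n N (by omega)]
      simp
  have hap : ∀ n, ‖((S (n + 1)).map u).sum - f‖ ≤ (1 / 2) ^ n := by
    intro n
    have h := cap (S n) n
    have e : ((S (n + 1)).map u).sum - f =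
        ((cor (S n) n).map u).sum - (f - ((S n).map u).sum - u (first (S n))) := by
      rw [hS, List.map_append, List.sum_append, List.map_cons, List.sum_cons]
      abel
    rwa [e]
  have hjinj : Function.Injective fun n => first (S n) := by
    have key : ∀ m n, m < n → first (S m) ≠ first (S n) := by
      intro m n hmn e
      apply hfirst (S n)
      rw [← e]
      exact (hpre hmn).subset (by rw [hS]; simp)
    intro m n e
    by_contra hne
    rcases lt_or_gt_of_ne hne with h | h
    · exact key m n h e
    · exact key n m h e.symm
  have hj0 : Tendsto (fun n => ‖u (first (S n))‖) atTop (𝓝 0) := by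
    have := hu.comp hjinj.tendsto_cofinite
    rwa [Nat.cofinite_eq_atTop] at this
  have herr : Tendsto (fun n : ℕ => 2 * (1 / 2 : ℝ) ^ n + 2 * ‖u (first (S (n + 1)))‖ +
      (1 / 2 : ℝ) ^ (n + 1)) atTop (𝓝 0) := by
    have h1 : Tendsto (fun n : ℕ => (1 / 2 : ℝ) ^ n) atTop (𝓝 0) :=
      tendsto_pow_atTop_nhds_zero_of_lt_one (by norm_num) (by norm_num)
    have h2 := ((h1.const_mul 2).add ((hj0.comp (tendsto_add_atTop_nat 1)).const_mul 2)).add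
      (h1.comp (tendsto_add_atTop_nat 1))
    simpa using h2
  have hstep : ∀ n N, (S (n + 1)).length ≤ N → N ≤ (S (n + 2)).length →
      ‖∑ k ∈ Finset.range N, u (τ k) - f‖ ≤
        2 * (1 / 2 : ℝ) ^ n + 2 * ‖u (first (S (n + 1)))‖ + (1 / 2 : ℝ) ^ (n + 1) := by
    intro n N h1 h2
    rw [hpart (n + 2) N h2]
    have ha := hap n
    have hpos : (0 : ℝ) ≤ (1 / 2) ^ (n + 1) := by positivity
    have hu0 := norm_nonneg (u (first (S (n + 1))))
    rw [hS (n + 1), List.take_append, List.take_of_length_le h1, List.map_append, List.sum_append]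
    rcases Nat.eq_zero_or_pos (N - (S (n + 1)).length) with h0 | h0
    · rw [h0, List.take_zero, List.map_nil, List.sum_nil, add_zero]
      have := norm_nonneg (((S (n + 1)).map u).sum - f)
      linarith
    · obtain ⟨k, hk⟩ := Nat.exists_eq_add_of_lt h0
      rw [hk, zero_add, List.take_succ_cons, List.map_cons, List.sum_cons]
      have hc := cpr (S (n + 1)) (n + 1) k
      have hg := norm_sub_le (f - ((S (n + 1)).map u).sum) (u (first (S (n + 1))))
      rw [norm_sub_rev f] at hg
      have e : ((S (n + 1)).map u).sum + (u (first (S (n + 1))) +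
          (((cor (S (n + 1)) (n + 1)).take k).map u).sum) - f =
          (((S (n + 1)).map u).sum - f) + u (first (S (n + 1))) +
            (((cor (S (n + 1)) (n + 1)).take k).map u).sum := by abel
      rw [e]
      have := norm_add₃_le (a := ((S (n + 1)).map u).sum - f) (b := u (first (S (n + 1))))
        (c := (((cor (S (n + 1)) (n + 1)).take k).map u).sum)
      linarith
  rw [tendsto_iff_norm_sub_tendsto_zero]
  refine Metric.tendsto_atTop.2 fun ε hε => ?_
  obtain ⟨n₀, hn₀⟩ := eventually_atTop.1 (herr.eventually (gt_mem_nhds hε))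
  refine ⟨(S (n₀ + 1)).length, fun N hN => ?_⟩
  -- the last stage completed before the `N`-th term
  have hex : ∃ n, N < (S (n + 1)).length := ⟨N, hlen (N + 1)⟩
  set n := Nat.find hex
  have hn : N < (S (n + 1)).length := Nat.find_spec hex
  have hn₀n : n₀ < n := by
    by_contra hle
    exact absurd (hn.trans_le (hpre (m := n + 1) (n := n₀ + 1) (by omega)).length_le) (by omega)
  obtain ⟨d, hd⟩ : ∃ d, n = d + 1 := ⟨n - 1, by omega⟩
  have hlow : (S (d + 1)).length ≤ N := not_lt.1 (Nat.find_min hex (m := d) (by omega))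
  rw [hd] at hn
  rw [Real.dist_eq, sub_zero, abs_of_nonneg (norm_nonneg _)]
  exact (hstep d N hlow hn.le).trans_lt (hn₀ d (by omega))

/-! ### Series supported on the diagonal -/

theorem sum_eq_sum_diagonal {A : Finset (ℕ+ × ℕ+)} {n : ℕ}
    (hA : ∀ k : ℕ+, (k, k) ∈ A ↔ (k : ℕ) ≤ n) (v : ℕ+ × ℕ+ → ℝ)
    (hv : ∀ i : ℕ+ × ℕ+, i.1 ≠ i.2 → v i = 0) :
    ∑ i ∈ A, v i = ∑ k ∈ Finset.range n, v (k.succPNat, k.succPNat) := by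
  have hinj : Set.InjOn (fun k : ℕ => (k.succPNat, k.succPNat)) (Finset.range n) :=
    fun j _ k _ h => Nat.succPNat_injective (Prod.ext_iff.1 h).1
  rw [← Finset.sum_image (f := v) hinj]
  symm
  refine Finset.sum_subset ?_ ?_
  · intro i hi
    obtain ⟨k, hk, rfl⟩ := Finset.mem_image.1 hi
    rw [hA, Nat.succPNat_coe]
    exact Finset.mem_range.1 hk
  · rintro ⟨j, k⟩ hi hni
    apply hv
    intro hjk
    obtain rfl : j = k := hjk
    apply hni
    refine Finset.mem_image.2 ⟨j.natPred, Finset.mem_range.2 ?_, ?_⟩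
    · have := (hA j).1 hi
      rw [← PNat.natPred_add_one j] at this
      omega
    · simp

/-- The terms outside `q` fill the off-diagonal positions; those in `q` follow `τ` on the
diagonal. -/
theorem exists_perm_diagonal {q : ℕ+ × ℕ+ → Prop} (hq : {i | ¬q i}.Infinite) (τ : ℕ ≃ {i // q i}) :
    ∃ σ : Equiv.Perm (ℕ+ × ℕ+), (∀ k : ℕ, σ (k.succPNat, k.succPNat) = τ k) ∧
      ∀ i : ℕ+ × ℕ+, i.1 ≠ i.2 → ¬q (σ i) := by
  classical
  let e₀ : {i : ℕ+ × ℕ+ // i.1 = i.2} ≃ ℕ :=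
    { toFun := fun i => i.1.1.natPred
      invFun := fun k => ⟨(k.succPNat, k.succPNat), rfl⟩
      left_inv := by
        rintro ⟨⟨a, b⟩, h⟩
        obtain rfl : a = b := h
        simp
      right_inv := fun k => by simp }
  have hoff : {i : ℕ+ × ℕ+ | ¬i.1 = i.2}.Infinite := by
    refine Set.infinite_of_injective_forall_mem (f := fun k : ℕ => ((k + 1).succPNat, 1)) ?_ ?_
    · intro j k h
      simpa using (Prod.ext_iff.1 h).1
    · intro k h
      have h' : (k + 1).succPNat = 1 := h
      have := congrArg PNat.val h'
      simp at this
  have : Infinite {i : ℕ+ × ℕ+ // ¬i.1 = i.2} := hoff.to_subtype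
  have : Infinite {i // ¬q i} := hq.to_subtype
  obtain ⟨e₁⟩ : Nonempty ({i : ℕ+ × ℕ+ // ¬i.1 = i.2} ≃ {i // ¬q i}) :=
    nonempty_equiv_of_countable
  refine ⟨Equiv.subtypeCongr (e₀.trans τ) e₁, fun k => ?_, fun i hi => ?_⟩
  · have h : e₀ ⟨(k.succPNat, k.succPNat), rfl⟩ = k := Nat.natPred_succPNat k
    simp [Equiv.subtypeCongr, Equiv.sumCompl, h]
  · have : Equiv.subtypeCongr (e₀.trans τ) e₁ i = e₁ ⟨i, hi⟩ := by
      simp [Equiv.subtypeCongr, Equiv.sumCompl, hi]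
    rw [this]
    exact (e₁ ⟨i, hi⟩).2

/-- A series whose terms vanish off the diagonal converges, both by rectangles and by disks, as soon
as its diagonal converges as a simple series. -/
theorem rectConverges_and_spherConverges_of_diagonal {μ f : ℝ × ℝ → ℝ}
    {u : ℕ+ × ℕ+ → ℝ × ℝ → ℝ} (hu : ∀ i : ℕ+ × ℕ+, i.1 ≠ i.2 → u i = 0)
    (h : Tendsto (fun n : ℕ => weightedDist μ
      (fun p => ∑ k ∈ Finset.range n, u (k.succPNat, k.succPNat) p) f) atTop (𝓝 0)) :
    RectConverges μ u f ∧ SpherConverges μ u f := by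
  have hu' : ∀ p, ∀ i : ℕ+ × ℕ+, i.1 ≠ i.2 → u i p = 0 := fun p i hi => by rw [hu i hi]; rfl
  constructor
  · have hr : ∀ N : ℕ+ × ℕ+, ∀ k : ℕ+, (k, k) ∈ rectIndices N ↔ (k : ℕ) ≤ min (N.1 : ℕ) N.2 := by
      intro N k
      simp [rectIndices]
    have ht : Tendsto (fun N : ℕ+ × ℕ+ => min (N.1 : ℕ) N.2) atTop atTop := by
      refine tendsto_atTop.2 fun b => ?_
      refine (eventually_ge_atTop (b.succPNat, b.succPNat)).mono fun N hN => ?_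
      have h1 : (b.succPNat : ℕ) ≤ N.1 := hN.1
      have h2 : (b.succPNat : ℕ) ≤ N.2 := hN.2
      rw [Nat.succPNat_coe] at h1 h2
      exact le_min (by omega) (by omega)
    refine (h.comp ht).congr fun N => ?_
    simp only [Function.comp_apply]
    congr 1
    funext p
    exact (sum_eq_sum_diagonal (hr N) (fun i => u i p) (hu' p)).symm
  · -- `k² + k² ≤ R²` means `k ≤ |R| / √2`
    have hr : ∀ R : ℝ, ∀ k : ℕ+, (k, k) ∈ spherIndices R ↔ (k : ℕ) ≤ ⌊|R| / √2⌋₊ := by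
      intro R k
      have h2 : (0 : ℝ) < √2 := by positivity
      rw [mem_spherIndices, Nat.le_floor_iff (by positivity), le_div_iff₀ h2, ← sq_le_sq₀
        (by positivity) (abs_nonneg R), mul_pow, Real.sq_sqrt zero_le_two, sq_abs, mul_two]
    have ht : Tendsto (fun R : ℝ => ⌊|R| / √2⌋₊) atTop atTop :=
      tendsto_nat_floor_atTop.comp (tendsto_abs_atTop_atTop.atTop_div_const (by positivity))
    refine (h.comp ht).congr fun R => ?_
    simp only [Function.comp_apply]
    congr 1
    funext p
    exact (sum_eq_sum_diagonal (hr R) (fun i => u i p) (hu' p)).symm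

/-! ### The universal double Walsh series -/

theorem exists_seq_frequently_eq (α : Type*) [Countable α] [Nonempty α] :
    ∃ e : ℕ → α, ∀ a N, ∃ s, N ≤ s ∧ e s = a := by
  obtain ⟨e, he⟩ := exists_surjective_nat α
  refine ⟨fun s => e s.unpair.1, fun a N => ?_⟩
  obtain ⟨m, rfl⟩ := he a
  exact ⟨Nat.pair m N, Nat.right_le_pair m N, by simp⟩

/-- Blocks with disjoint spectra, one after another, attached to a sequence in which every step
function recurs infinitely often. -/
theorem exists_isWalshBlock_seq :
    ∃ (tgt : ℕ → StepCode) (L : ℕ → List ((ℕ+ × ℕ+) × ℝ)) (B : ℕ → Set (ℝ × ℝ)),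
      (∀ t N, ∃ s, N ≤ s ∧ tgt s = t) ∧
      (∀ s, IsWalshBlock (dyadicStep (tgt s)) ((1 / 2) ^ s) (s + 1) (L s) (B s)) ∧
      ∀ s s', s < s' → ∀ t ∈ L s, ∀ t' ∈ L s', t.1.1 < t'.1.1 := by
  obtain ⟨tgt, htgt⟩ := exists_seq_frequently_eq StepCode
  choose L B hLB using fun (s N : ℕ) =>
    exists_isWalshBlock (tgt s) (δ := (1 / 2) ^ s) (by positivity) N
  obtain ⟨M, hM0, hM⟩ : ∃ M : ℕ → ℕ, M 0 = 1 ∧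
      ∀ s, M (s + 1) = M s + ((L s (M s)).map fun t => (t.1.1 : ℕ)).sum + 1 :=
    ⟨fun s => Nat.rec 1 (fun s N => N + ((L s N).map fun t => (t.1.1 : ℕ)).sum + 1) s, rfl,
      fun s => rfl⟩
  have hmono : Monotone M := monotone_nat_of_le_succ fun s => by rw [hM]; omega
  have hlow : ∀ s, s + 1 ≤ M s := by
    intro s
    induction s with
    | zero => rw [hM0]
    | succ s ih => rw [hM]; omega
  refine ⟨tgt, fun s => L s (M s), fun s => B s (M s), htgt, fun s => ?_, ?_⟩
  · exact { hLB s (M s) with lt_fst := fun t ht => (hlow s).trans_lt ((hLB s (M s)).lt_fst t ht) }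
  · intro s s' hss t ht t' ht'
    have h1 : (t.1.1 : ℕ) ≤ ((L s (M s)).map fun t => (t.1.1 : ℕ)).sum :=
      List.le_sum_of_mem (List.mem_map_of_mem (f := fun t => (t.1.1 : ℕ)) ht)
    have h2 := (hLB s' (M s')).lt_fst t' ht'
    have h3 : M (s + 1) ≤ M s' := hmono hss
    rw [hM] at h3
    rw [← PNat.coe_lt_coe]
    omega

/-- The coefficients of the series that is composed of the given lists of terms. -/
theorem exists_coeff {L : ℕ → List ((ℕ+ × ℕ+) × ℝ)} (hnd : ∀ s, ((L s).map Prod.fst).Nodup)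
    (hL : ∀ s s', s < s' → ∀ t ∈ L s, ∀ t' ∈ L s', t.1.1 < t'.1.1) :
    ∃ c : ℕ+ × ℕ+ → ℝ, (∀ s, ∀ t ∈ L s, c t.1 = t.2) ∧
      ∀ i, (∀ s, ∀ t ∈ L s, t.1 ≠ i) → c i = 0 := by
  classical
  have huniq : ∀ s s', ∀ t ∈ L s, ∀ t' ∈ L s', t.1 = t'.1 → t = t' := by
    intro s s' t ht t' ht' h
    rcases lt_trichotomy s s' with hs | rfl | hs
    · exact absurd (hL s s' hs t ht t' ht') (by rw [h]; exact lt_irrefl _)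
    · exact List.inj_on_of_nodup_map (hnd s) ht ht' h
    · exact absurd (hL s' s hs t' ht' t ht) (by rw [h]; exact lt_irrefl _)
  refine ⟨fun i => if h : ∃ r : ℝ, ∃ s, (i, r) ∈ L s then h.choose else 0, ?_, ?_⟩
  · intro s t ht
    have h : ∃ r : ℝ, ∃ s, (t.1, r) ∈ L s := ⟨t.2, s, ht⟩
    simp only [dif_pos h]
    obtain ⟨s', hs'⟩ := h.choose_spec
    exact congrArg Prod.snd (huniq s' s _ hs' t ht rfl)
  · intro i hi
    refine dif_neg ?_
    rintro ⟨r, s, h⟩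
    exact hi s _ h rfl

/-- The block `s` is small in `ℓ^(2 + 2^(-s))`, hence in `ℓ^q` once `2^(-s) < q - 2`. -/
theorem summable_coeff {tgt : ℕ → StepCode} {L : ℕ → List ((ℕ+ × ℕ+) × ℝ)}
    {B : ℕ → Set (ℝ × ℝ)}
    (hB : ∀ s, IsWalshBlock (dyadicStep (tgt s)) ((1 / 2) ^ s) (s + 1) (L s) (B s))
    (hL : ∀ s s', s < s' → ∀ t ∈ L s, ∀ t' ∈ L s', t.1.1 < t'.1.1) {c : ℕ+ × ℕ+ → ℝ}
    (hc : ∀ s, ∀ t ∈ L s, c t.1 = t.2) (hc0 : ∀ i, (∀ s, ∀ t ∈ L s, t.1 ≠ i) → c i = 0)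
    {q : ℝ} (hq : 2 < q) : Summable fun i => |c i| ^ q := by
  let φ : (Σ s, Fin (L s).length) → ℕ+ × ℕ+ := fun x => ((L x.1)[x.2]).1
  have hφ : Function.Injective φ := by
    have key : ∀ s s' (k : Fin (L s).length) (k' : Fin (L s').length), s < s' →
        φ ⟨s, k⟩ ≠ φ ⟨s', k'⟩ := fun s s' k k' hs h =>
      absurd (hL s s' hs _ (List.getElem_mem k.2) _ (List.getElem_mem k'.2))
        (by rw [show (L s)[(k : ℕ)].1 = (L s')[(k' : ℕ)].1 from h]; exact lt_irrefl _)
    rintro ⟨s, k⟩ ⟨s', k'⟩ h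
    rcases lt_trichotomy s s' with hs | rfl | hs
    · exact absurd h (key s s' k k' hs)
    · have h' : ((L s).map Prod.fst)[(k : ℕ)]'(by simp) =
          ((L s).map Prod.fst)[(k' : ℕ)]'(by simp) := by
        rw [List.getElem_map, List.getElem_map]; exact h
      have := (hB s).nodup.getElem_inj_iff.1 h'
      rw [Fin.ext this]
    · exact absurd h.symm (key s' s k' k hs)
  rw [← hφ.summable_iff]
  swap
  · intro i hi
    rw [hc0 i, abs_zero, Real.zero_rpow (by linarith)]
    intro s t ht hti
    obtain ⟨k, hk, rfl⟩ := List.getElem_of_mem ht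
    exact hi ⟨⟨s, ⟨k, hk⟩⟩, hti⟩
  refine (summable_sigma_of_nonneg (f := (fun i => |c i| ^ q) ∘ φ)
    fun x => Real.rpow_nonneg (abs_nonneg _) _).2 ⟨fun s => (hasSum_fintype _).summable, ?_⟩
  have hsum : ∀ s, ∑' k : Fin (L s).length, ((fun i => |c i| ^ q) ∘ φ) ⟨s, k⟩ =
      ((L s).map fun t => |t.2| ^ q).sum := by
    intro s
    rw [tsum_fintype, ← Fin.sum_univ_fun_getElem]
    refine Finset.sum_congr rfl fun k _ => ?_
    change |c ((L s)[(k : ℕ)]).1| ^ q = _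
    rw [hc s _ (List.getElem_mem k.2)]
  simp only [hsum]
  have hgeo : Summable fun s : ℕ => (1 / 2 : ℝ) ^ s :=
    summable_geometric_of_lt_one (by norm_num) (by norm_num)
  refine Summable.of_norm_bounded_eventually_nat hgeo ?_
  filter_upwards [hgeo.tendsto_atTop_zero.eventually (gt_mem_nhds (sub_pos.2 hq))] with s hs
  have hnn : ∀ (r : ℝ), ∀ x ∈ (L s).map (fun t => |t.2| ^ r), 0 ≤ x := by
    intro r x hx
    obtain ⟨t, -, rfl⟩ := List.mem_map.1 hx
    exact Real.rpow_nonneg (abs_nonneg _) _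
  rw [Real.norm_of_nonneg (List.sum_nonneg (hnn q))]
  refine (List.sum_le_sum fun t ht => ?_).trans (hB s).sum_rpow_le
  have hpos : (0 : ℝ) < (1 / 2) ^ s := by positivity
  have h1 : |t.2| ^ (2 + (1 / 2 : ℝ) ^ s) ≤ 1 :=
    ((List.single_le_sum (hnn _) _ (List.mem_map_of_mem ht)).trans (hB s).sum_rpow_le).trans
      (pow_le_one₀ (by norm_num) (by norm_num))
  have h2 : |t.2| ≤ 1 := by
    by_contra hlt
    exact absurd h1 (not_le.2 (Real.one_lt_rpow (not_le.1 hlt) (by linarith)))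
  exact Real.rpow_le_rpow_of_exponent_ge' (abs_nonneg _) h2 (by linarith) (by linarith)

/-! ### The weight -/

/-- A weight that equals one off a small set and is so small on the sets `B s` that it compensates
the constants `K s`. -/
theorem exists_weight {B : ℕ → Set (ℝ × ℝ)} (hBm : ∀ s, MeasurableSet (B s))
    (hB : ∀ s, volume.restrict unitSquare (B s) ≤ ENNReal.ofReal ((1 / 2) ^ s)) (K : ℕ → ℝ)
    {ε : ℝ} (hε : 0 < ε) :
    ∃ m : ℝ × ℝ → ℝ, Measurable m ∧ (∀ p, 0 < m p ∧ m p ≤ 1) ∧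
      volume {p | p ∈ unitSquare ∧ m p ≠ 1} < ENNReal.ofReal ε ∧
      ∃ s₀ : ℕ, ∀ᵐ p ∂(volume.restrict unitSquare), ∀ s ≥ s₀, p ∈ B s → K s * m p ≤ 1 := by
  obtain ⟨s₀, hs₀⟩ := exists_pow_lt_of_lt_one (half_pos hε) (by norm_num : (1 / 2 : ℝ) < 1)
  have hgeo : HasSum (fun s : ℕ => (1 / 2 : ℝ) ^ (s + s₀)) (2 * (1 / 2) ^ s₀) := by
    simp only [pow_add]
    exact hasSum_geometric_two.mul_right _
  have htsum : ∑' s, volume.restrict unitSquare (B (s + s₀)) ≤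
      ENNReal.ofReal (2 * (1 / 2) ^ s₀) := by
    rw [← hgeo.tsum_eq, ENNReal.ofReal_tsum_of_nonneg (fun _ => by positivity) hgeo.summable]
    exact ENNReal.tsum_le_tsum fun s => hB _
  -- `D` is infinite only on a null set, where `toReal` makes the weight equal to one
  let D : ℝ × ℝ → ENNReal := fun p =>
    ∑' s, (B (s + s₀)).indicator (fun _ => ENNReal.ofReal (K (s + s₀))) p
  have hDm : Measurable D := Measurable.tsum fun s => measurable_const.indicator (hBm _)
  have hD0 : ∀ p, 0 ≤ (D p).toReal := fun p => ENNReal.toReal_nonneg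
  refine ⟨fun p => (1 + (D p).toReal)⁻¹, (measurable_const.add hDm.ennreal_toReal).inv,
    fun p => ⟨by have := hD0 p; positivity, inv_le_one_of_one_le₀ (by linarith [hD0 p])⟩, ?_,
    s₀, ?_⟩
  · have hsub : {p | p ∈ unitSquare ∧ (1 + (D p).toReal)⁻¹ ≠ 1} ⊆
        (⋃ s, B (s + s₀)) ∩ unitSquare := by
      rintro p ⟨hp, hne⟩
      refine ⟨?_, hp⟩
      by_contra hnot
      apply hne
      have : D p = 0 := by
        refine ENNReal.tsum_eq_zero.2 fun s => Set.indicator_of_notMem ?_ _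
        exact fun h => hnot (Set.mem_iUnion.2 ⟨s, h⟩)
      simp [this]
    refine (measure_mono hsub).trans_lt ?_
    rw [← Measure.restrict_apply (MeasurableSet.iUnion fun s => hBm _)]
    refine ((measure_iUnion_le _).trans htsum).trans_lt ?_
    exact (ENNReal.ofReal_lt_ofReal_iff hε).2 (by linarith)
  · have hev := ae_eventually_notMem (htsum.trans_lt ENNReal.ofReal_lt_top).ne
    filter_upwards [hev] with p hp s hs hps
    obtain ⟨n, hn⟩ := eventually_atTop.1 hp
    have hfin : D p ≠ ⊤ := by
      have : D p = ∑ s ∈ Finset.range n,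
          (B (s + s₀)).indicator (fun _ => ENNReal.ofReal (K (s + s₀))) p := by
        refine tsum_eq_sum fun s hs => Set.indicator_of_notMem (hn s ?_) _
        simpa using hs
      rw [this]
      refine (ENNReal.sum_lt_top.2 fun s _ => ?_).ne
      exact (Set.indicator_le_self _ _ _).trans_lt ENNReal.ofReal_lt_top
    have hle : ENNReal.ofReal (K s) ≤ D p := by
      have h := ENNReal.le_tsum (f := fun s =>
        (B (s + s₀)).indicator (fun _ => ENNReal.ofReal (K (s + s₀))) p) (s - s₀)
      simp only [Nat.sub_add_cancel hs] at h
      rwa [Set.indicator_of_mem hps] at h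
    have hle' : K s ≤ (D p).toReal := (ENNReal.ofReal_le_iff_le_toReal hfin).1 hle
    have := hD0 p
    rw [← div_eq_mul_inv, div_le_one (by positivity)]
    linarith

/-! ### Blocks in a weighted space -/

theorem abs_walshPoly_le (L : List ((ℕ+ × ℕ+) × ℝ)) (p : ℝ × ℝ) :
    |walshPoly L p| ≤ (L.map fun t => |t.2|).sum := by
  induction L with
  | nil => simp [walshPoly]
  | cons t L ih =>
    have h : walshPoly (t :: L) p = t.2 * walshPair t.1 p + walshPoly L p := by simp [walshPoly]
    rw [h, List.map_cons, List.sum_cons]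
    refine (abs_add_le _ _).trans (add_le_add ?_ ih)
    rw [abs_mul, abs_walshPair, mul_one]

theorem measurable_walshPoly (L : List ((ℕ+ × ℕ+) × ℝ)) : Measurable (walshPoly L) := by
  induction L with
  | nil => exact measurable_const
  | cons t L ih =>
    have h : walshPoly (t :: L) = fun p => t.2 * walshPair t.1 p + walshPoly L p := by
      funext p; simp [walshPoly]
    rw [h]
    exact ((measurable_walshPair _).const_mul _).add ih

theorem integrable_walshPoly (L : List ((ℕ+ × ℕ+) × ℝ)) (lam : Measure (ℝ × ℝ))
    [IsFiniteMeasure lam] : Integrable (walshPoly L) lam :=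
  Integrable.of_bound (measurable_walshPoly L).aestronglyMeasurable _
    (ae_of_all _ fun p => abs_walshPoly_le L p)

theorem sum_take_abs_le (L : List ((ℕ+ × ℕ+) × ℝ)) (k : ℕ) :
    ((L.take k).map fun t => |t.2|).sum ≤ (L.map fun t => |t.2|).sum := by
  refine ((List.take_sublist k L).map _).sum_le_sum fun x hx => ?_
  obtain ⟨t, -, rfl⟩ := List.mem_map.1 hx
  exact abs_nonneg _

section Block

variable {g : ℝ × ℝ → ℝ} {δ η V : ℝ} {N : ℕ} {L : List ((ℕ+ × ℕ+) × ℝ)} {B : Set (ℝ × ℝ)}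
  {lam : Measure (ℝ × ℝ)}

theorem IsWalshBlock.integral_abs_sub_le (h : IsWalshBlock g δ N L B)
    (hlam : lam ≤ volume.restrict unitSquare) (hgi : Integrable g lam) (hV : ∀ p, |g p| ≤ V)
    (hη : lam.real B * ((L.map fun t => |t.2|).sum + V) ≤ η) :
    ∫ p, |walshPoly L p - g p| ∂lam ≤ η := by
  have : IsFiniteMeasure lam := isFiniteMeasure_of_le _ hlam
  set C := (L.map fun t => |t.2|).sum + V
  have hle : ∀ p, |walshPoly L p - g p| ≤ B.indicator (fun _ => C) p := by
    intro p
    by_cases hp : p ∈ B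
    · rw [Set.indicator_of_mem hp]
      exact (abs_sub _ _).trans (add_le_add (abs_walshPoly_le L p) (hV p))
    · rw [Set.indicator_of_notMem hp, h.eq_off p hp, sub_self, abs_zero]
  refine (integral_mono ((integrable_walshPoly L lam).sub hgi).abs
    ((integrable_const C).indicator h.measurableSet) hle).trans ?_
  rwa [integral_indicator_const _ h.measurableSet, smul_eq_mul]

theorem IsWalshBlock.integral_abs_take_le (h : IsWalshBlock g δ N L B)
    (hlam : lam ≤ volume.restrict unitSquare) (hgi : Integrable g lam) (hV : ∀ p, |g p| ≤ V)
    (hη : lam.real B * ((L.map fun t => |t.2|).sum + V) ≤ η) (k : ℕ) :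
    ∫ p, |walshPoly (L.take k) p| ∂lam ≤ ∫ p, |g p| ∂lam + δ + η := by
  have : IsFiniteMeasure lam := isFiniteMeasure_of_le _ hlam
  set C := (L.map fun t => |t.2|).sum + V
  have hV0 : 0 ≤ V := (abs_nonneg _).trans (hV 0)
  obtain ⟨R, R0, Ri, Rδ, hR⟩ := h.prefix_le k
  have Ri' : Integrable R lam := Ri.mono_measure hlam
  have hind : Integrable (B.indicator fun _ => C) lam :=
    (integrable_const C).indicator h.measurableSet
  have hle : ∀ p, |walshPoly (L.take k) p| ≤ |g p| + R p + B.indicator (fun _ => C) p := by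
    intro p
    by_cases hp : p ∈ B
    · rw [Set.indicator_of_mem hp]
      have h1 := (abs_walshPoly_le (L.take k) p).trans (sum_take_abs_le L k)
      have h2 := R0 p
      have h3 := abs_nonneg (g p)
      change _ ≤ _ + ((L.map fun t => |t.2|).sum + V)
      linarith
    · rw [Set.indicator_of_notMem hp, add_zero]
      exact hR p hp
  refine (integral_mono (integrable_walshPoly _ lam).abs ((hgi.abs.add Ri').add hind) hle).trans ?_
  have e : ∫ p, (|g p| + R p + B.indicator (fun _ => C) p) ∂lam =
      ∫ p, |g p| ∂lam + ∫ p, R p ∂lam + ∫ p, B.indicator (fun _ => C) p ∂lam :=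
    (integral_add (hgi.abs.add Ri') hind).trans (congrArg (· + _) (integral_add hgi.abs Ri'))
  have e' : ∫ p, (|g p| + R p + B.indicator (fun _ => C) p) ∂lam ≤
      ∫ p, |g p| ∂lam + δ + η := by
    rw [e, integral_indicator_const _ h.measurableSet, smul_eq_mul]
    have := (integral_mono_measure hlam (ae_of_all _ R0) Ri).trans Rδ
    linarith
  exact e'

end Block

/-! ### The weighted space as an `L¹` space -/

/-- The measure with density `m` on the unit square. -/
noncomputable def weightMeasure (m : ℝ × ℝ → ℝ) : Measure (ℝ × ℝ) :=
  (volume.restrict unitSquare).withDensity fun p => ((m p).toNNReal : ENNReal)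

theorem weightMeasure_le {m : ℝ × ℝ → ℝ} (hm1 : ∀ p, m p ≤ 1) :
    weightMeasure m ≤ volume.restrict unitSquare := by
  refine (withDensity_mono (ae_of_all _ fun p => ?_)).trans withDensity_one.le
  exact ENNReal.coe_le_one_iff.2 (Real.toNNReal_le_one.2 (hm1 p))

theorem weightedDist_eq {m : ℝ × ℝ → ℝ} (hm : Measurable m) (hm0 : ∀ p, 0 < m p)
    (f g : ℝ × ℝ → ℝ) : weightedDist m f g = ∫ p, |f p - g p| ∂(weightMeasure m) := by
  rw [weightMeasure, integral_withDensity_eq_integral_smul hm.real_toNNReal, weightedDist]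
  refine integral_congr_ae (ae_of_all _ fun p => ?_)
  change _ = ((m p).toNNReal : ℝ) * _
  rw [Real.coe_toNNReal _ (hm0 p).le, mul_comm]

theorem MemWeightedL1.integrable {m f : ℝ × ℝ → ℝ} (hm : Measurable m) (hm0 : ∀ p, 0 < m p)
    (hf : MemWeightedL1 m f) : Integrable f (weightMeasure m) := by
  rw [weightMeasure, integrable_withDensity_iff_integrable_smul hm.real_toNNReal]
  refine Integrable.mono hf.2.integrable
    (hm.real_toNNReal.coe_nnreal_real.aemeasurable.mul hf.1).aestronglyMeasurable
    (ae_of_all _ fun p => le_of_eq ?_)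
  change ‖((m p).toNNReal : ℝ) * f p‖ = _
  rw [Real.coe_toNNReal _ (hm0 p).le, norm_mul, norm_mul, Real.norm_eq_abs |f p|, abs_abs,
    Real.norm_eq_abs (f p), mul_comm]

theorem memWeightedL1_walshTerm {m : ℝ × ℝ → ℝ} (hm : Measurable m) (hm0 : ∀ p, 0 < m p)
    (hm1 : ∀ p, m p ≤ 1) (c : ℕ+ × ℕ+ → ℝ) (i : ℕ+ × ℕ+) : MemWeightedL1 m (walshTerm c i) := by
  have h : walshTerm c i = fun p => c i * walshPair i p := funext (walshTerm_eq c i)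
  have hw : Measurable (walshTerm c i) := by rw [h]; exact (measurable_walshPair i).const_mul _
  refine ⟨hw.aemeasurable, ?_⟩
  refine Integrable.of_bound (hw.norm.mul hm).aestronglyMeasurable |c i| (ae_of_all _ fun p => ?_)
  rw [Real.norm_eq_abs, abs_mul, abs_abs, walshTerm_eq, abs_mul, abs_walshPair, mul_one,
    abs_of_pos (hm0 p)]
  exact mul_le_of_le_one_right (abs_nonneg _) (hm1 p)

theorem weightMeasure_real_mul_le {m : ℝ × ℝ → ℝ} {B : Set (ℝ × ℝ)} (hB : MeasurableSet B)
    {K : ℝ} (hK : 0 < K) (h : ∀ᵐ p ∂(volume.restrict unitSquare), p ∈ B → K * m p ≤ 1) :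
    (weightMeasure m).real B * K ≤ 1 := by
  have h1 : weightMeasure m B ≤ ENNReal.ofReal K⁻¹ := by
    rw [weightMeasure, withDensity_apply _ hB]
    calc ∫⁻ p in B, ((m p).toNNReal : ENNReal) ∂(volume.restrict unitSquare)
        ≤ ∫⁻ _ in B, ENNReal.ofReal K⁻¹ ∂(volume.restrict unitSquare) := by
          refine lintegral_mono_ae ?_
          rw [ae_restrict_iff' hB]
          filter_upwards [h] with p hp hpB
          refine ENNReal.ofReal_le_ofReal ?_
          rw [← one_div, le_div_iff₀ hK, mul_comm]
          exact hp hpB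
      _ ≤ ENNReal.ofReal K⁻¹ := by
          rw [setLIntegral_const]
          exact mul_le_of_le_one_right' prob_le_one
  have h2 : (weightMeasure m).real B ≤ K⁻¹ :=
    ENNReal.toReal_le_of_le_ofReal (by positivity) h1
  calc (weightMeasure m).real B * K ≤ K⁻¹ * K := by gcongr
    _ = 1 := inv_mul_cancel₀ hK.ne'

theorem integrable_walshPair (i : ℕ+ × ℕ+) (lam : Measure (ℝ × ℝ)) [IsFiniteMeasure lam] :
    Integrable (walshPair i) lam :=
  Integrable.of_bound (measurable_walshPair i).aestronglyMeasurable 1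
    (ae_of_all _ fun p => (abs_walshPair i p).le)

theorem integrable_walshTerm (c : ℕ+ × ℕ+ → ℝ) (i : ℕ+ × ℕ+) (lam : Measure (ℝ × ℝ))
    [IsFiniteMeasure lam] : Integrable (walshTerm c i) lam :=
  ((integrable_walshPair i lam).const_mul (c i)).congr
    (ae_of_all _ fun p => (walshTerm_eq c i p).symm)

theorem sum_map_toL1_walshTerm (c : ℕ+ × ℕ+ → ℝ) (lam : Measure (ℝ × ℝ)) [IsFiniteMeasure lam]
    (l : List ((ℕ+ × ℕ+) × ℝ)) (hl : ∀ t ∈ l, c t.1 = t.2) :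
    ((l.map Prod.fst).map fun i => (integrable_walshTerm c i lam).toL1).sum =
      (integrable_walshPoly l lam).toL1 := by
  induction l with
  | nil => exact (Integrable.toL1_zero _).symm
  | cons t l ih =>
    rw [List.map_cons, List.map_cons, List.sum_cons,
      ih fun t' ht' => hl t' (List.mem_cons_of_mem _ ht'), ← Integrable.toL1_add,
      Integrable.toL1_eq_toL1_iff]
    refine ae_of_all _ fun p => ?_
    simp [walshPoly, walshTerm_eq, hl t (by simp)]

/-! ### Universality -/

/-- The terms with first index different from `1` can be arranged into a simple series converging to
`f`: a block of a late stage whose target is close to `g` serves as approximation of `g`. -/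
theorem exists_rearrangement_tendsto_weightedDist {tgt : ℕ → StepCode}
    {L : ℕ → List ((ℕ+ × ℕ+) × ℝ)} {B : ℕ → Set (ℝ × ℝ)}
    (htgt : ∀ t N, ∃ s, N ≤ s ∧ tgt s = t)
    (hB : ∀ s, IsWalshBlock (dyadicStep (tgt s)) ((1 / 2) ^ s) (s + 1) (L s) (B s))
    {c : ℕ+ × ℕ+ → ℝ} (hc : ∀ s, ∀ t ∈ L s, c t.1 = t.2)
    (hclim : Tendsto (fun i => |c i|) cofinite (𝓝 0))
    {V : ℕ → ℝ} (hV : ∀ s p, |dyadicStep (tgt s) p| ≤ V s)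
    {m : ℝ × ℝ → ℝ} (hm : Measurable m) (hm0 : ∀ p, 0 < m p) (hm1 : ∀ p, m p ≤ 1) {s₀ : ℕ}
    (hmB : ∀ s ≥ s₀, (weightMeasure m).real (B s) * (((L s).map fun t => |t.2|).sum + V s) ≤
      (1 / 2) ^ s)
    {f : ℝ × ℝ → ℝ} (hf : MemWeightedL1 m f) :
    ∃ τ : ℕ ≃ {i : ℕ+ × ℕ+ // i.1 ≠ 1}, Tendsto (fun n => weightedDist m
      (fun p => ∑ k ∈ Finset.range n, walshTerm c (τ k) p) f) atTop (𝓝 0) := by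
  set lam := weightMeasure m
  have hlam : lam ≤ volume.restrict unitSquare := weightMeasure_le hm1
  have : IsFiniteMeasure lam := isFiniteMeasure_of_le _ hlam
  let w : ℕ+ × ℕ+ → (ℝ × ℝ →₁[lam] ℝ) := fun i => (integrable_walshTerm c i lam).toL1
  let u : {i : ℕ+ × ℕ+ // i.1 ≠ 1} → (ℝ × ℝ →₁[lam] ℝ) := fun i => w i
  have hnorm : ∀ {h : ℝ × ℝ → ℝ} (hi : Integrable h lam), ‖hi.toL1‖ = ∫ p, |h p| ∂lam :=
    fun hi => L1.norm_of_fun_eq_integral_norm hi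
  have hmass : lam.real Set.univ ≤ 1 := by
    have h1 : lam Set.univ ≤ 1 := (hlam Set.univ).trans prob_le_one
    exact ENNReal.toReal_le_of_le_ofReal zero_le_one (by simpa using h1)
  have hw : ∀ i, ‖w i‖ ≤ |c i| := by
    intro i
    rw [hnorm]
    simp only [walshTerm_eq, abs_mul, abs_walshPair, mul_one]
    rw [integral_const, smul_eq_mul]
    exact mul_le_of_le_one_left (abs_nonneg _) hmass
  have hinf : Infinite {i : ℕ+ × ℕ+ // i.1 ≠ 1} := by
    refine Set.Infinite.to_subtype (s := {i : ℕ+ × ℕ+ | i.1 ≠ 1}) ?_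
    refine Set.infinite_of_injective_forall_mem (f := fun k : ℕ => ((2 : ℕ+), k.succPNat)) ?_ ?_
    · exact fun j k h => Nat.succPNat_injective (Prod.ext_iff.1 h).2
    · intro k
      change (2 : ℕ+) ≠ 1
      decide
  have hfi : Integrable f lam := hf.integrable hm hm0
  have H : ∀ (g : ℝ × ℝ →₁[lam] ℝ) (F : Finset {i : ℕ+ × ℕ+ // i.1 ≠ 1}) (ε : ℝ), 0 < ε →
      ∃ l : List {i : ℕ+ × ℕ+ // i.1 ≠ 1}, l.Nodup ∧ (∀ i ∈ l, i ∉ F) ∧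
        ‖(l.map u).sum - g‖ ≤ ε ∧ ∀ k, ‖((l.take k).map u).sum‖ ≤ ‖g‖ + ε := by
    intro g F ε hε
    have hg : Integrable g lam := L1.integrable_coeFn g
    obtain ⟨t, hti, ht⟩ := exists_integral_abs_sub_dyadicStep_le hlam hg
      (by positivity : 0 < ε / 3)
    obtain ⟨n₁, hn₁⟩ := exists_pow_lt_of_lt_one (by positivity : 0 < ε / 3)
      (by norm_num : (1 / 2 : ℝ) < 1)
    obtain ⟨s, hs, hst⟩ := htgt t (s₀ + n₁ + ∑ i ∈ F, (i.1.1 : ℕ))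
    have hsε : (1 / 2 : ℝ) ^ s ≤ ε / 3 :=
      (pow_le_pow_of_le_one (by norm_num) (by norm_num) (by omega)).trans hn₁.le
    have hblock := hB s
    have hVs := hV s
    rw [hst] at hblock hVs
    have hη := hmB s (by omega)
    have hsub := hblock.integral_abs_sub_le hlam hti hVs hη
    have hpre := hblock.integral_abs_take_le hlam hti hVs hη
    have hfst : ∀ t ∈ L s, t.1.1 ≠ 1 := by
      intro t ht h1
      have := hblock.lt_fst t ht
      rw [h1, PNat.one_coe] at this
      omega
    have hnd := hblock.nodup
    obtain ⟨l, hl⟩ : ∃ l : List {i : ℕ+ × ℕ+ // i.1 ≠ 1},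
        l.map Subtype.val = (L s).map Prod.fst := by
      have h : ∀ i ∈ (L s).map Prod.fst, i.1 ≠ 1 := by
        intro i hi
        obtain ⟨t, ht, rfl⟩ := List.mem_map.1 hi
        exact hfst t ht
      lift (L s).map Prod.fst to List {i : ℕ+ × ℕ+ // i.1 ≠ 1} using h with l
      exact ⟨l, rfl⟩
    have hwl : ∀ k, ((l.take k).map u).sum =
        (integrable_walshPoly ((L s).take k) lam).toL1 := by
      intro k
      have h : ((L s).take k).map Prod.fst = (l.take k).map Subtype.val := by
        rw [List.map_take, ← hl, List.map_take]
      rw [← sum_map_toL1_walshTerm c lam _ fun t ht => hc s t (List.mem_of_mem_take ht), h,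
        List.map_map]
      rfl
    have hgd : ‖hti.toL1 - g‖ ≤ ε / 3 := by
      have e : hti.toL1 - g = (hti.sub hg).toL1 := by
        rw [Integrable.toL1_sub _ _ hti hg, Integrable.toL1_coeFn]
      rw [e, hnorm]
      refine (le_of_eq ?_).trans ht
      exact integral_congr_ae (ae_of_all _ fun p => abs_sub_comm _ _)
    refine ⟨l, ?_, ?_, ?_, ?_⟩
    · rw [← hl] at hnd
      exact hnd.of_map _
    · intro i hi hiF
      have h1 : (i : ℕ+ × ℕ+) ∈ (L s).map Prod.fst := by
        rw [← hl]; exact List.mem_map_of_mem hi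
      obtain ⟨t', ht', e⟩ := List.mem_map.1 h1
      have h2 := hblock.lt_fst t' ht'
      rw [e] at h2
      have h3 := Finset.single_le_sum (f := fun i : {i : ℕ+ × ℕ+ // i.1 ≠ 1} => (i.1.1 : ℕ))
        (fun _ _ => Nat.zero_le _) hiF
      omega
    · have h1 := hwl l.length
      have hlen : l.length = (L s).length := by
        have := congrArg List.length hl
        simpa using this
      rw [List.take_length] at h1
      rw [h1]
      have h2 : ‖(integrable_walshPoly ((L s).take l.length) lam).toL1 - hti.toL1‖ ≤
          (1 / 2) ^ s := by
        rw [← Integrable.toL1_sub, hnorm, hlen, List.take_length]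
        exact hsub
      have h3 := norm_sub_le_norm_sub_add_norm_sub
        (integrable_walshPoly ((L s).take l.length) lam).toL1 hti.toL1 g
      linarith
    · intro k
      rw [hwl, hnorm]
      have h1 := hpre k
      rw [← hnorm hti] at h1
      have h2 := norm_le_norm_add_norm_sub' hti.toL1 g
      linarith
  obtain ⟨τ, hτ⟩ := exists_rearrangement_tendsto u
    ((squeeze_zero (fun _ => norm_nonneg _) hw hclim).comp Subtype.val_injective.tendsto_cofinite)
    H hfi.toL1
  refine ⟨τ, ?_⟩
  rw [tendsto_iff_norm_sub_tendsto_zero] at hτ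
  refine hτ.congr fun n => ?_
  have hsi : Integrable (fun p => ∑ k ∈ Finset.range n, walshTerm c (τ k) p) lam :=
    integrable_finsetSum _ fun k _ => integrable_walshTerm c _ lam
  have hsum : ∑ k ∈ Finset.range n, w (τ k) = hsi.toL1 := by
    clear hτ
    induction n with
    | zero => exact (Integrable.toL1_zero _).symm
    | succ n ih =>
      rw [Finset.sum_range_succ, ih (integrable_finsetSum _ fun k _ =>
        integrable_walshTerm c _ lam), ← Integrable.toL1_add, Integrable.toL1_eq_toL1_iff]
      exact ae_of_all _ fun p => (Finset.sum_range_succ _ _).symm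
  rw [hsum, ← Integrable.toL1_sub, hnorm, weightedDist_eq hm hm0]
  rfl

theorem theorem4 :
    ∃ c : ℕ+ × ℕ+ → ℝ,
      (∀ q : ℝ, 2 < q → Summable fun i => |c i| ^ q) ∧
      ∀ ε : ℝ, 0 < ε →
        ∃ μ : ℝ × ℝ → ℝ,
          Measurable μ ∧
          (∀ p ∈ unitSquare, 0 < μ p ∧ μ p ≤ 1) ∧
          volume {p | p ∈ unitSquare ∧ μ p ≠ 1} < ENNReal.ofReal ε ∧
          IsUniversalRearrangements μ (walshTerm c) := by
  obtain ⟨tgt, L, B, htgt, hB, hL⟩ := exists_isWalshBlock_seq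
  obtain ⟨c, hc, hc0⟩ := exists_coeff (fun s => (hB s).nodup) hL
  have hsummable : ∀ q : ℝ, 2 < q → Summable fun i => |c i| ^ q :=
    fun q hq => summable_coeff hB hL hc hc0 hq
  have hclim : Tendsto (fun i => |c i|) cofinite (𝓝 0) := by
    have h := ((hsummable 3 (by norm_num)).tendsto_cofinite_zero).rpow_const (p := 3⁻¹)
      (Or.inr (by norm_num))
    rw [Real.zero_rpow (by norm_num)] at h
    refine h.congr fun i => ?_
    rw [← Real.rpow_mul (abs_nonneg _)]
    norm_num
  -- all frequencies used exceed one, which leaves infinitely many vanishing coefficients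
  have hcone : ∀ i : ℕ+ × ℕ+, i.1 = 1 → c i = 0 := by
    intro i hi
    refine hc0 i fun s t ht hti => ?_
    have := (hB s).lt_fst t ht
    rw [hti, hi, PNat.one_coe] at this
    omega
  choose V hV0 hV using fun s => exists_abs_stepCode_le (tgt s)
  have hM0 : ∀ s, 0 ≤ ((L s).map fun t => |t.2|).sum := by
    intro s
    refine List.sum_nonneg fun x hx => ?_
    obtain ⟨t, -, rfl⟩ := List.mem_map.1 hx
    exact abs_nonneg _
  refine ⟨c, hsummable, fun ε hε => ?_⟩
  obtain ⟨m, hm, hm01, hmvol, s₀, hmB⟩ := exists_weight (fun s => (hB s).measurableSet)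
    (fun s => (hB s).measure_le)
    (fun s => 2 ^ s * (((L s).map fun t => |t.2|).sum + V s + 1)) hε
  have hm0 : ∀ p, 0 < m p := fun p => (hm01 p).1
  have hm1 : ∀ p, m p ≤ 1 := fun p => (hm01 p).2
  refine ⟨m, hm, fun p _ => hm01 p, hmvol, memWeightedL1_walshTerm hm hm0 hm1 c, fun f hf => ?_⟩
  have hmB' : ∀ s ≥ s₀, (weightMeasure m).real (B s) *
      (((L s).map fun t => |t.2|).sum + V s) ≤ (1 / 2) ^ s := by
    intro s hs
    have h0 := hM0 s
    have h1 := hV0 s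
    have h := weightMeasure_real_mul_le (m := m) (hB s).measurableSet
      (K := 2 ^ s * (((L s).map fun t => |t.2|).sum + V s + 1)) (by positivity)
      (hmB.mono fun p hp => hp s hs)
    have h2 : (weightMeasure m).real (B s) * (((L s).map fun t => |t.2|).sum + V s) ≤
        (weightMeasure m).real (B s) * (((L s).map fun t => |t.2|).sum + V s + 1) :=
      mul_le_mul_of_nonneg_left (by linarith) measureReal_nonneg
    refine h2.trans ?_
    rw [one_div, inv_pow, ← one_div, le_div_iff₀ (by positivity)]
    linarith
  obtain ⟨τ, hτ⟩ := exists_rearrangement_tendsto_weightedDist htgt hB hc hclim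
    (fun s p => hV s _) hm hm0 hm1 hmB' hf
  have hones : {i : ℕ+ × ℕ+ | ¬i.1 ≠ 1}.Infinite := by
    refine Set.infinite_of_injective_forall_mem (f := fun k : ℕ => ((1 : ℕ+), k.succPNat)) ?_ ?_
    · exact fun j k h => Nat.succPNat_injective (Prod.ext_iff.1 h).2
    · exact fun k => not_not.2 rfl
  obtain ⟨σ, hσ, hσ'⟩ := exists_perm_diagonal hones τ
  refine ⟨σ, rectConverges_and_spherConverges_of_diagonal (fun i hi => ?_) ?_⟩
  · funext p
    rw [walshTerm_eq, hcone _ (not_not.1 (hσ' i hi)), zero_mul]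
    rfl
  · simpa only [hσ] using hτ
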